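/- Let $G$ be a finite set, let $G^*\subset\mathbb R^G$ be the simplex of probability distributions on $G$, let $\|\cdot\|$ and $\langle\cdot,\cdot\rangle$ be the Euclidean norm and inner product on $\mathbb R^G$, and let $T:G^*\to G^*$ be a continuous map. Let $Q=\{q\in G^*: T(q)=q\}$ be its set of fixed points. Let $k_0\ge 1$ be an integer, let $p_0\in G^*$, and on a probability space let $(k_n)_{n\ge0}$ be integer-valued random variables starting at the constant $k_0$ with $k_{n+1}\ge k_n+1$ for all $n$, and let $X_1,X_2,\dots$ be random vectors, each of which is the indicator vector of an element of $G$. Define recursively $$p_{n+1}=\frac{k_n}{k_{n+1}}\,p_n+\frac1{k_{n+1}}\sum_{i=k_n+1}^{k_{n+1}}X_i,\qquad n\ge0,$$ and let $\mathcal F_n=\sigma(X_1,\dots,X_{k_n},k_1,\dots,k_{n+1})$. Suppose that for every $n\ge1$, conditionally on $\mathcal F_n$, $$\sum_{i=k_n+1}^{k_{n+1}}X_i\sim\mathrm{Multinomial}\bigl(T(p_n),\,k_{n+1}-k_n\bigr).$$ Assume: A1. $Q$ is finite and contains a point $q_0$ that is contracting, i.e. $\|T(p)-q_0\|<\|p-q_0\|$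 for all $p\in G^*\setminus Q$; moreover, every $q\in Q\setminus\{q_0\}$ lies on the boundary of $G^*$, i.e. its support is a proper subset of $G$. A2. For every $q\in Q\setminus\{q_0\}$, let $c_q\in\{0,1\}^G$ be the vector with entry $0$ in the coordinates where $q$ has positive mass and entry $1$ in the coordinates where $q$ has no mass. Then $\langle c_q,p_0\rangle>0$, and $$\liminf_{\substack{p\to q\\ p\in G^*,\ \langle c_q,p\rangle\ne0}}\frac{\langle c_q,T(p)\rangle}{\langle c_q,p\rangle}>1.$$ A3. There is a constant $C>1$ with $C-1<\|q-q'\|$ for all distinct $q,q'\in Q$, such that almost surely $k_{n+1}/k_n\le C$ for all $n$. Then $p_n\to q_0$ almost surely as $n\to\infty$. -/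

import Mathlib

open MeasureTheory ProbabilityTheory Filter Topology

/-- The simplex of probability distributions over the finite set `G`, as a subset of Euclidean
space (so that `‖·‖` is the Euclidean norm). -/
def simplex (G : Type*) [Fintype G] : Set (EuclideanSpace ℝ G) :=
  {p | (∀ g, 0 ≤ p g) ∧ ∑ g, p g = 1}

/-- The set of fixed points of `T` in the simplex. -/
def fixedPts {G : Type*} [Fintype G] (T : EuclideanSpace ℝ G → EuclideanSpace ℝ G) :
    Set (EuclideanSpace ℝ G) :=
  {q | q ∈ simplex G ∧ T q = q}

/-- The vector with 0's in the coordinates where `q` has positive mass and 1's in the coordinates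
where `q` has no mass. -/
noncomputable def missingVec {G : Type*} (q : EuclideanSpace ℝ G) : EuclideanSpace ℝ G :=
  open Classical in WithLp.toLp 2 fun g => if q g = 0 then 1 else 0

/-- Condition A1: finitely many fixed points; `q₀` is a contracting fixed point; every other
fixed point has a proper subset of `G` as its support. -/
structure ConditionA1 {G : Type*} [Fintype G] (T : EuclideanSpace ℝ G → EuclideanSpace ℝ G)
    (q₀ : EuclideanSpace ℝ G) : Prop where
  finite : (fixedPts T).Finite
  mem : q₀ ∈ fixedPts T
  contracting : ∀ p ∈ simplex G, p ∉ fixedPts T → ‖T p - q₀‖ < ‖p - q₀‖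
  boundary : ∀ q ∈ fixedPts T, q ≠ q₀ → ∃ g, q g = 0

/-- Condition A2: every other fixed point `q` is repelling in the direction of its missing
support, and the initial distribution charges that missing support.  The lower limit is over the
points `p` of the simplex that are not orthogonal to `missingVec q`; it is taken in the extended
reals. -/
structure ConditionA2 {G : Type*} [Fintype G] (T : EuclideanSpace ℝ G → EuclideanSpace ℝ G)
    (q₀ p₀ : EuclideanSpace ℝ G) : Prop where
  init_pos : ∀ q ∈ fixedPts T, q ≠ q₀ → 0 < inner ℝ (missingVec q) p₀
  repelling : ∀ q ∈ fixedPts T, q ≠ q₀ →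
    (1 : EReal) < liminf
      (fun p : EuclideanSpace ℝ G =>
        ((inner ℝ (missingVec q) (T p) / inner ℝ (missingVec q) p : ℝ) : EReal))
      (𝓝[{p | p ∈ simplex G ∧ inner ℝ (missingVec q) p ≠ 0}] q)

/-- Condition A3: the ratios `k (n + 1) / k n` are bounded by a constant `C > 1` such that `C - 1`
is less than the distance between any two distinct fixed points. -/
def ConditionA3 {G Ω : Type*} [Fintype G] [MeasurableSpace Ω] (μ : Measure Ω)
    (T : EuclideanSpace ℝ G → EuclideanSpace ℝ G) (k : ℕ → Ω → ℕ) : Prop :=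
  ∃ C : ℝ, 1 < C ∧
    (∀ q ∈ fixedPts T, ∀ q' ∈ fixedPts T, q ≠ q' → C - 1 < ‖q - q'‖) ∧
    ∀ᵐ ω ∂μ, ∀ n, (k (n + 1) ω : ℝ) / (k n ω : ℝ) ≤ C

/-- The sum of the label indicators of the balls `k n + 1, …, k (n + 1)`, where `X i` is the label
of ball `i`. -/
def batchSum {G Ω : Type*} [DecidableEq G] (k : ℕ → Ω → ℕ) (X : ℕ → Ω → G) (n : ℕ) (ω : Ω) :
    G → ℕ :=
  ∑ i ∈ Finset.Ioc (k n ω) (k (n + 1) ω), Pi.single (X i ω) 1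

/-- The sequence of empirical distributions. -/
noncomputable def empirical {G Ω : Type*} [DecidableEq G] (k : ℕ → Ω → ℕ) (X : ℕ → Ω → G)
    (p₀ : EuclideanSpace ℝ G) : ℕ → Ω → EuclideanSpace ℝ G
  | 0, _ => p₀
  | n + 1, ω =>
      ((k n ω : ℝ) / (k (n + 1) ω : ℝ)) • empirical k X p₀ n ω +
        (1 / (k (n + 1) ω : ℝ)) • WithLp.toLp 2 fun g => (batchSum k X n ω g : ℝ)

/-- The σ-algebra generated by `X 1, …, X (k n)` and `k 1, …, k (n + 1)`.  As `k n` is random, the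
first family is recorded by the variables equal to `X i` if `i ≤ k n` and to `none` otherwise. -/
@[reducible] def urnSigma {G Ω : Type*} (k : ℕ → Ω → ℕ) (X : ℕ → Ω → G) (n : ℕ) : MeasurableSpace Ω :=
  (⨆ i ≥ 1, MeasurableSpace.comap (fun ω => if i ≤ k n ω then some (X i ω) else none) ⊤) ⊔
    ⨆ j ∈ Finset.Icc 1 (n + 1), MeasurableSpace.comap (k j) ⊤

/-- The probability that a Multinomial(`t`, `N`) vector equals `m`. -/
noncomputable def multinomialProb {G : Type*} [Fintype G] (t : EuclideanSpace ℝ G) (N : ℕ) (m : G → ℕ) : ℝ :=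
  if ∑ g, m g = N then (Nat.multinomial Finset.univ m : ℝ) * ∏ g, t g ^ m g else 0

/-! With a_n = 1 - k_n / k_{n+1}, the recursion is the stochastic approximation scheme p_{n+1} = p_n
+ a_n (T p_n - p_n) + ξ_n, where ξ_n is the conditionally centred batch divided by k_{n+1}.

Noise. From n = 1 on, the conditional variance of a coordinate of ξ_n is at most (k_{n+1} - k_n) /
k_{n+1}² ≤ 1/k_n - 1/k_{n+1}, which telescopes. So the noise, even with bounded predictable
coefficients, sums to an L²-bounded martingale, which converges (`ae_tendsto_sum_noise`).

Convergence to some fixed point. D p = ‖p - q₀‖² - ‖T p - q₀‖² is nonnegative on the simplex and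
vanishes there exactly at the fixed points. By convexity of the square, a_n D(p_n) is at most the
decrease of ‖p_n - q₀‖² plus noise terms with convergent sum, so ∑ a_n D(p_n) < ∞, whereas ∑ a_n = ∞
because k_n → ∞. Hence D(p_n) is small infinitely often, and `tendsto_of_summable_drift` shows that
the path cannot leave the resulting cluster point: T keeps nearby points near it, and crossing a
shell around it costs a fixed amount of ∑ a_n D(p_n).

Exclusion of q ≠ q₀. Let y_n be the mass of p_n off the support of q and A_n the compensator of the
count k_n y_n. A martingale with weights 1/(1 + A_{n+1}) and Kronecker's lemma make the count
comparable to A_n once A_n → ∞. If p_n → q, then A2 makes the conditional mean proportion at least λ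
y_n with λ > 1; this surplus makes (1 + A_n)/k_n eventually nondecreasing, so y_n stays away from 0
(`not_tendsto_zero_of_compensator`), a contradiction. -/

/-! ### Multinomial moments -/

/-- The binomial moments of the number of draws in `S` under a multinomial distribution. -/
theorem sum_multinomialProb_mul_choose {G : Type*} [Fintype G] [DecidableEq G]
    {t : EuclideanSpace ℝ G} (ht : ∑ g, t g = 1) (N : ℕ) (S : Finset G) (j : ℕ) :
    ∑ m ∈ Finset.piAntidiag Finset.univ N,
        ((∑ g ∈ S, m g).choose j : ℝ) * multinomialProb t N m =
      (N.choose j : ℝ) * (∑ g ∈ S, t g) ^ j := by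
  -- Generating function: the factor 1 + X marks a draw in S, and the claim compares coefficients of
  -- X^j in the N-th power.
  have hsum : ∑ g, Polynomial.C (t g) * (if g ∈ S then 1 + Polynomial.X else 1) =
      1 + Polynomial.C (∑ g ∈ S, t g) * Polynomial.X := by
    have h1 : ∀ g, Polynomial.C (t g) * (if g ∈ S then 1 + Polynomial.X else 1) =
        Polynomial.C (t g) + if g ∈ S then Polynomial.C (t g) * Polynomial.X else 0 := by
      intro g
      split_ifs <;> ring
    simp_rw [h1, Finset.sum_add_distrib]
    rw [← map_sum, ht, Finset.sum_ite_mem, Finset.univ_inter, ← Finset.sum_mul, ← map_sum]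
    simp
  have hpow := Finset.sum_pow_eq_sum_piAntidiag Finset.univ
    (fun g => Polynomial.C (t g) * (if g ∈ S then 1 + Polynomial.X else 1)) N
  rw [hsum] at hpow
  have hcoeff := congrArg (fun p : Polynomial ℝ => p.coeff j) hpow
  have hcomp : (1 + Polynomial.C (∑ g ∈ S, t g) * Polynomial.X) ^ N =
      ((1 + Polynomial.X : Polynomial ℝ) ^ N).comp
        (Polynomial.C (∑ g ∈ S, t g) * Polynomial.X) := by
    simp
  simp only [hcomp, Polynomial.comp_C_mul_X_coeff, Polynomial.coeff_one_add_X_pow,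
    Polynomial.finsetSum_coeff] at hcoeff
  rw [hcoeff]
  refine Finset.sum_congr rfl fun m hm => ?_
  have hmN : ∑ g, m g = N := (Finset.mem_piAntidiag.1 hm).1
  have hprod : ∏ g, (Polynomial.C (t g) * (if g ∈ S then 1 + Polynomial.X else 1)) ^ m g =
      Polynomial.C (∏ g, t g ^ m g) * (1 + Polynomial.X) ^ (∑ g ∈ S, m g) := by
    simp_rw [mul_pow, Finset.prod_mul_distrib, map_prod, map_pow, ite_pow, one_pow]
    rw [Finset.prod_ite_mem, Finset.univ_inter, Finset.prod_pow_eq_pow_sum]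
  rw [hprod, ← Polynomial.C_eq_natCast, Polynomial.coeff_C_mul, Polynomial.coeff_C_mul,
    Polynomial.coeff_one_add_X_pow, multinomialProb, if_pos hmN]
  ring

/-! ### Deterministic convergence lemmas -/

/-- Kronecker's lemma. -/
theorem tendsto_weighted_sum_div_of_tendsto {b d : ℕ → ℝ} (hb : Monotone b)
    (hbtop : Tendsto b atTop atTop) {l : ℝ}
    (hd : Tendsto (fun n => ∑ i ∈ Finset.range n, d i) atTop (𝓝 l)) :
    Tendsto (fun n => (∑ i ∈ Finset.range n, b (i + 1) * d i) / b n) atTop (𝓝 0) := by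
  set c : ℕ → ℝ := fun n => ∑ i ∈ Finset.range n, d i - l with hc
  have hc0 : Tendsto c atTop (𝓝 0) := by simpa [hc] using hd.sub_const l
  -- Summation by parts against the null sequence c leaves a weighted average of c, with weights b
  -- (i + 1) - b i of diverging sum.
  have habel : ∀ n, ∑ i ∈ Finset.range n, b (i + 1) * d i =
      b n * c n - b 0 * c 0 - ∑ i ∈ Finset.range n, (b (i + 1) - b i) * c i := by
    intro n
    induction n with
    | zero => simp
    | succ n ih =>
      rw [Finset.sum_range_succ, Finset.sum_range_succ, ih]
      have : c (n + 1) = c n + d n := by simp only [hc, Finset.sum_range_succ]; ring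
      rw [this]; ring
  have htel : ∀ n, ∑ i ∈ Finset.range n, (b (i + 1) - b i) = b n - b 0 :=
    fun n => Finset.sum_range_sub b n
  have hdivtop : Tendsto (fun n => ∑ i ∈ Finset.range n, (b (i + 1) - b i)) atTop atTop := by
    simp_rw [htel]
    exact tendsto_atTop_add_const_right _ _ hbtop
  have hlo : (fun n => ∑ i ∈ Finset.range n, (b (i + 1) - b i) * c i) =o[atTop]
      fun n => ∑ i ∈ Finset.range n, (b (i + 1) - b i) := by
    refine Asymptotics.IsLittleO.sum_range ?_ (fun n => sub_nonneg.2 (hb n.le_succ)) hdivtop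
    have := (Asymptotics.isBigO_refl (fun n => b (n + 1) - b n) atTop).mul_isLittleO
      ((Asymptotics.isLittleO_one_iff ℝ).2 hc0)
    simpa using this
  have hbig : (fun n => ∑ i ∈ Finset.range n, (b (i + 1) - b i)) =O[atTop] b := by
    simp_rw [htel]
    refine (Asymptotics.isBigO_refl b atTop).sub ?_
    exact (Asymptotics.isLittleO_const_left.2
      (Or.inr (tendsto_norm_atTop_atTop.comp hbtop))).isBigO
  have h1 := (hlo.trans_isBigO hbig).tendsto_div_nhds_zero
  have h2 : Tendsto (fun n => b 0 * c 0 / b n) atTop (𝓝 0) := hbtop.const_div_atTop _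
  have h3 := (hc0.sub h2).sub h1
  simp only [sub_zero] at h3
  refine h3.congr' ?_
  filter_upwards [hbtop.eventually_gt_atTop 0] with n hn
  rw [habel]
  field_simp

/-- If a perturbed averaging scheme has a summable drift `a n * D (x n)` while `∑ a n` diverges,
and the zeros of `D` are finitely many fixed points, then it converges to one of these zeros. -/
theorem tendsto_of_summable_drift {E : Type*} [NormedAddCommGroup E] [NormedSpace ℝ E]
    {K : Set E} (hK : IsCompact K) {T : E → E} (hT : ContinuousOn T K) {D : E → ℝ}
    (hD : ContinuousOn D K) (hD0 : ∀ p ∈ K, 0 ≤ D p) (hDfix : ∀ p ∈ K, D p = 0 → T p = p)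
    (hfin : {p | p ∈ K ∧ D p = 0}.Finite) {x e : ℕ → E} (hx : ∀ n, x n ∈ K) {a : ℕ → ℝ}
    (ha0 : ∀ n, 0 ≤ a n) (ha1 : ∀ n, a n ≤ 1) (ha : ¬ Summable a) (he : CauchySeq e)
    (hstep : ∀ n, x (n + 1) = x n + a n • (T (x n) - x n) + (e (n + 1) - e n))
    (hsum : Summable fun n => a n * D (x n)) :
    ∃ q ∈ K, D q = 0 ∧ Tendsto x atTop (𝓝 q) := by
  obtain ⟨R, hR0, hR⟩ : ∃ R > 0, ∀ p ∈ K, ‖T p - p‖ ≤ R := by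
    obtain ⟨R, hR⟩ := hK.exists_bound_of_continuousOn (hT.sub continuousOn_id)
    exact ⟨max R 1, by positivity, fun p hp => (hR p hp).trans (le_max_left _ _)⟩
  -- Otherwise a would eventually be dominated by (n + 1) * (a * D), hence summable.
  have hfreq : ∀ n : ℕ, ∃ᶠ j in atTop, D (x j) < 1 / ((n : ℝ) + 1) := by
    intro n hn
    refine ha ((hsum.mul_left ((n : ℝ) + 1)).of_norm_bounded_eventually_nat ?_)
    filter_upwards [hn] with j hj
    rw [Real.norm_of_nonneg (ha0 j)]
    have hn1 : (0 : ℝ) < (n : ℝ) + 1 := by positivity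
    have h1 : 1 ≤ ((n : ℝ) + 1) * D (x j) := by
      rw [not_lt, div_le_iff₀ hn1] at hj
      linarith
    nlinarith [ha0 j]
  obtain ⟨φ, hφ, hφD⟩ := extraction_forall_of_frequently hfreq
  obtain ⟨q, hqK, ψ, hψ, hlim⟩ := hK.tendsto_subseq fun n => hx (φ n)
  have hDq : D q = 0 := by
    have h1 : Tendsto (fun n => D (x (φ (ψ n)))) atTop (𝓝 (D q)) :=
      (hD q hqK).tendsto.comp (tendsto_nhdsWithin_iff.2 ⟨hlim, .of_forall fun n => hx _⟩)
    refine tendsto_nhds_unique h1 (squeeze_zero (fun n => hD0 _ (hx _)) (fun n => (hφD _).le) ?_)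
    exact tendsto_one_div_add_atTop_nhds_zero_nat.comp hψ.tendsto_atTop
  refine ⟨q, hqK, hDq, ?_⟩
  obtain ⟨ε₀, hε₀, hiso⟩ : ∃ ε₀ > 0, ∀ p ∈ K, D p = 0 → ‖p - q‖ ≤ ε₀ → p = q := by
    have hopen : IsOpen ({p | p ∈ K ∧ D p = 0} \ {q})ᶜ := (hfin.subset Set.sdiff_subset).isClosed.isOpen_compl
    obtain ⟨r, hr, hball⟩ := Metric.isOpen_iff.1 hopen q (by simp)
    refine ⟨r / 2, by positivity, fun p hp hp0 hpq => ?_⟩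
    have := @hball p (by rw [Metric.mem_ball, dist_eq_norm]; linarith)
    by_contra hne
    exact this ⟨⟨hp, hp0⟩, hne⟩
  rw [Metric.tendsto_atTop]
  intro η hη
  set ε := min ε₀ η with hε
  have hε0 : 0 < ε := lt_min hε₀ hη
  -- Near q the target T p is also near q, so a step from there cannot jump away, however large a
  -- is.
  obtain ⟨ρ, hρ0, hρ⟩ : ∃ ρ > 0, ∀ p ∈ K, ‖p - q‖ < ρ → ‖T p - q‖ < ε / 4 := by
    obtain ⟨ρ, hρ0, hρ⟩ := Metric.continuousOn_iff.1 hT q hqK (ε / 4) (by positivity)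
    refine ⟨ρ, hρ0, fun p hp hpq => ?_⟩
    have := hρ p hp (by rwa [dist_eq_norm])
    rwa [hDfix q hqK hDq, dist_eq_norm] at this
  set ρ' := min ρ (ε / 4) with hρ'
  have hρ'0 : 0 < ρ' := lt_min hρ0 (by positivity)
  obtain ⟨δ, hδ0, hδ⟩ : ∃ δ > 0, ∀ p ∈ K, ρ' ≤ ‖p - q‖ → ‖p - q‖ ≤ ε → δ ≤ D p := by
    have hcomp : IsCompact (K ∩ {p | ρ' ≤ ‖p - q‖ ∧ ‖p - q‖ ≤ ε}) := by
      refine hK.inter_right (IsClosed.and ?_ ?_)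
      · exact isClosed_le continuous_const (by fun_prop)
      · exact isClosed_le (by fun_prop) continuous_const
    rcases (K ∩ {p | ρ' ≤ ‖p - q‖ ∧ ‖p - q‖ ≤ ε}).eq_empty_or_nonempty with hemp | hne
    · refine ⟨1, one_pos, fun p hp h1 h2 => ?_⟩
      exact absurd (show p ∈ (∅ : Set E) from hemp ▸ ⟨hp, h1, h2⟩) (Set.notMem_empty p)
    · obtain ⟨y, hy, hmin⟩ := hcomp.exists_isMinOn hne (hD.mono Set.inter_subset_left)
      refine ⟨D y, lt_of_le_of_ne (hD0 y hy.1) fun h0 => ?_, fun p hp h1 h2 => hmin ⟨hp, h1, h2⟩⟩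
      have hyq := hiso y hy.1 h0.symm (hy.2.2.trans (min_le_left _ _))
      have := hy.2.1
      rw [hyq, sub_self, norm_zero] at this
      linarith
  set f : ℕ → ℝ := fun n => ∑ i ∈ Finset.range n, a i * D (x i) with hf
  have hfc : CauchySeq f := hsum.hasSum.tendsto_sum_nat.cauchySeq
  obtain ⟨N₁, hN₁⟩ := Metric.cauchySeq_iff.1 he (ε / 8) (by positivity)
  obtain ⟨N₂, hN₂⟩ := Metric.cauchySeq_iff.1 hfc (δ / R * (ε / 8)) (by positivity)
  have hev := (Metric.tendsto_nhds.1 hlim (ε / 2) (by positivity)).and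
    (((hφ.tendsto_atTop.comp hψ.tendsto_atTop).eventually_ge_atTop N₁).and
      ((hφ.tendsto_atTop.comp hψ.tendsto_atTop).eventually_ge_atTop N₂))
  obtain ⟨i, hi, hi1, hi2⟩ := hev.exists
  set s := φ (ψ i) with hs
  -- s' is s or the time just after the latest visit to the inner ball. Since s', the path has moved
  -- only through the shell, where D ≥ δ: apart from the noise, a step has length at most a * R ≤ (R
  -- / δ) * (a * D).
  have key : ∀ t, s ≤ t → ∃ s', s ≤ s' ∧ s' ≤ t ∧
      ‖x t - q - (e t - e s')‖ ≤ ε / 2 + R / δ * (f t - f s') := by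
    intro t ht
    induction t, ht using Nat.le_induction with
    | base =>
      refine ⟨s, le_rfl, le_rfl, ?_⟩
      have : dist (x s) q < ε / 2 := hi
      rw [dist_eq_norm] at this
      simpa using this.le
    | succ t ht ih =>
      obtain ⟨s', hs1, hs2, hbound⟩ := ih
      have he' : ‖e (t + 1) - e t‖ < ε / 8 := by
        rw [← dist_eq_norm]
        exact hN₁ _ (le_trans hi1 (ht.trans t.le_succ)) _ (le_trans hi1 ht)
      by_cases hc : ρ' ≤ ‖x t - q‖
      · have hlt : ‖x t - q‖ ≤ ε := by
          have h1 : ‖e t - e s'‖ < ε / 8 := by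
            rw [← dist_eq_norm]
            exact hN₁ _ (le_trans hi1 ht) _ (le_trans hi1 hs1)
          have h2 : f t - f s' < δ / R * (ε / 8) := by
            refine (le_abs_self _).trans_lt ?_
            rw [← Real.dist_eq]
            exact hN₂ _ (le_trans hi2 ht) _ (le_trans hi2 hs1)
          have h3 : R / δ * (f t - f s') ≤ ε / 8 := by
            calc R / δ * (f t - f s') ≤ R / δ * (δ / R * (ε / 8)) := by gcongr
              _ = ε / 8 := by field_simp
          have h4 : ‖x t - q‖ ≤ ‖x t - q - (e t - e s')‖ + ‖e t - e s'‖ := by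
            simpa using norm_add_le (x t - q - (e t - e s')) (e t - e s')
          linarith
        refine ⟨s', hs1, hs2.trans t.le_succ, ?_⟩
        have hsplit : x (t + 1) - q - (e (t + 1) - e s') =
            (x t - q - (e t - e s')) + a t • (T (x t) - x t) := by
          rw [hstep t]; abel
        have hDt := hδ _ (hx t) hc hlt
        have h5 : a t * R ≤ R / δ * (a t * D (x t)) := by
          rw [div_mul_eq_mul_div, le_div_iff₀ hδ0]
          have := mul_le_mul_of_nonneg_left hDt (mul_nonneg (ha0 t) hR0.le)
          linarith
        have h6 : f (t + 1) = f t + a t * D (x t) := Finset.sum_range_succ _ _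
        calc ‖x (t + 1) - q - (e (t + 1) - e s')‖
            ≤ ‖x t - q - (e t - e s')‖ + ‖a t • (T (x t) - x t)‖ := by
              rw [hsplit]; exact norm_add_le _ _
          _ ≤ (ε / 2 + R / δ * (f t - f s')) + a t * R := by
              rw [norm_smul, Real.norm_of_nonneg (ha0 t)]
              exact add_le_add hbound (mul_le_mul_of_nonneg_left (hR _ (hx t)) (ha0 t))
          _ ≤ ε / 2 + R / δ * (f (t + 1) - f s') := by
              rw [h6]; linarith
      -- A visit to the inner ball restarts the clock: the next point is within ε / 4 + ε / 8 of q.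
      · refine ⟨t + 1, ht.trans t.le_succ, le_rfl, ?_⟩
        rw [not_le] at hc
        have hT' := hρ _ (hx t) (hc.trans_le (min_le_left _ _))
        have hxt : ‖x t - q‖ < ε / 4 := hc.trans_le (min_le_right _ _)
        have hsplit : x (t + 1) - q =
            (1 - a t) • (x t - q) + a t • (T (x t) - q) + (e (t + 1) - e t) := by
          rw [hstep t, sub_smul, one_smul, smul_sub, smul_sub, smul_sub]; abel
        have h7 : ‖x (t + 1) - q‖ ≤ (1 - a t) * ‖x t - q‖ + a t * ‖T (x t) - q‖ + ε / 8 := by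
          rw [hsplit]
          refine (norm_add₃_le).trans ?_
          rw [norm_smul, norm_smul, Real.norm_of_nonneg (ha0 t),
            Real.norm_of_nonneg (sub_nonneg.2 (ha1 t))]
          linarith
        have h8 : (1 - a t) * ‖x t - q‖ ≤ (1 - a t) * (ε / 4) :=
          mul_le_mul_of_nonneg_left hxt.le (sub_nonneg.2 (ha1 t))
        have h9 := mul_le_mul_of_nonneg_left hT'.le (ha0 t)
        simp only [sub_self, mul_zero, sub_zero, add_zero]
        linarith
  refine ⟨s, fun t ht => ?_⟩
  obtain ⟨s', hs1, hs2, hbound⟩ := key t ht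
  have h1 : ‖e t - e s'‖ < ε / 8 := by
    rw [← dist_eq_norm]
    exact hN₁ _ (le_trans hi1 ht) _ (le_trans hi1 hs1)
  have h2 : f t - f s' < δ / R * (ε / 8) := by
    refine (le_abs_self _).trans_lt ?_
    rw [← Real.dist_eq]
    exact hN₂ _ (le_trans hi2 ht) _ (le_trans hi2 hs1)
  have h3 : R / δ * (f t - f s') ≤ ε / 8 := by
    calc R / δ * (f t - f s') ≤ R / δ * (δ / R * (ε / 8)) := by gcongr
      _ = ε / 8 := by field_simp
  have h4 : ‖x t - q‖ ≤ ‖x t - q - (e t - e s')‖ + ‖e t - e s'‖ := by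
    simpa using norm_add_le (x t - q - (e t - e s')) (e t - e s')
  rw [dist_eq_norm]
  have : ε ≤ η := min_le_right _ _
  linarith

/-- A multiplicatively growing count `k n * y n`, whose increments follow a compensator that is at
least `lam` times the proportional one, cannot have a vanishing proportion `y n`. -/
theorem not_tendsto_zero_of_compensator {k y b τ A : ℕ → ℝ} {lam l : ℝ} (hlam : 1 < lam)
    (hk0 : ∀ n, 0 < k n) (hkmono : ∀ n, k n ≤ k (n + 1)) (hktop : Tendsto k atTop atTop)
    (hy0 : 0 < y 0) (hb : ∀ n, 0 ≤ b n) (hτ : ∀ n, 0 ≤ τ n)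
    (hstep : ∀ n, k (n + 1) * y (n + 1) = k n * y n + b n)
    (hA0 : A 0 = 0) (hA : ∀ n, A (n + 1) = A n + (k (n + 1) - k n) * τ n)
    (hrep : ∀ᶠ n in atTop, lam * y n ≤ τ n)
    (hconv : Tendsto (fun n => ∑ i ∈ Finset.range n,
      (1 / (1 + A (i + 1))) * (b i - (k (i + 1) - k i) * τ i)) atTop (𝓝 l)) :
    ¬ Tendsto y atTop (𝓝 0) := by
  have hAmono : Monotone A := monotone_nat_of_le_succ fun n => by
    rw [hA]
    nlinarith [mul_nonneg (sub_nonneg.2 (hkmono n)) (hτ n)]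
  have hApos : ∀ n, 0 < 1 + A n := fun n => by
    have := hAmono n.zero_le
    rw [hA0] at this
    linarith
  have hsmono : Monotone fun n => k n * y n := monotone_nat_of_le_succ fun n => by
    rw [hstep]; linarith [hb n]
  set s₀ := k 0 * y 0 with hs₀
  have hs₀pos : 0 < s₀ := mul_pos (hk0 0) hy0
  -- The count k * y never drops below s₀, so τ ≥ y ≥ s₀ / k eventually, and A grows at least like
  -- s₀ * log k.
  have hAtop : Tendsto A atTop atTop := by
    obtain ⟨n₀, hn₀⟩ := eventually_atTop.1 hrep
    have hbound : ∀ n, n₀ ≤ n → A n₀ + s₀ * (Real.log (k n) - Real.log (k n₀)) ≤ A n := by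
      intro n hn
      induction n, hn using Nat.le_induction with
      | base => simp
      | succ n hn ih =>
        have h1 := hn₀ n hn
        have h2 : s₀ ≤ k n * y n := hsmono n.zero_le
        have h3 : Real.log (k (n + 1)) - Real.log (k n) ≤ k (n + 1) / k n - 1 := by
          rw [← Real.log_div (hk0 _).ne' (hk0 _).ne']
          exact Real.log_le_sub_one_of_pos (div_pos (hk0 _) (hk0 _))
        have h4 : s₀ * (k (n + 1) / k n - 1) ≤ (k (n + 1) - k n) * τ n := by
          have h5 : s₀ / k n ≤ τ n := by
            rw [div_le_iff₀ (hk0 n)]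
            have hy : 0 ≤ y n := by
              by_contra hneg
              have := mul_neg_of_pos_of_neg (hk0 n) (not_le.1 hneg)
              linarith
            nlinarith [hk0 n, mul_nonneg (sub_nonneg.2 hlam.le) hy]
          calc s₀ * (k (n + 1) / k n - 1) = (k (n + 1) - k n) * (s₀ / k n) := by
                have := (hk0 n).ne'
                field_simp
            _ ≤ _ := mul_le_mul_of_nonneg_left h5 (sub_nonneg.2 (hkmono n))
        have h6 := mul_le_mul_of_nonneg_left h3 hs₀pos.le
        rw [hA]
        linarith
    refine tendsto_atTop_mono' atTop (eventually_atTop.2 ⟨n₀, hbound⟩) ?_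
    refine tendsto_atTop_add_const_left _ _ (Tendsto.const_mul_atTop hs₀pos ?_)
    exact tendsto_atTop_add_const_right _ _ (Real.tendsto_log_atTop.comp hktop)
  have hbtop : Tendsto (fun n => 1 + A n) atTop atTop := tendsto_atTop_add_const_left _ _ hAtop
  have hkron := tendsto_weighted_sum_div_of_tendsto (b := fun n => 1 + A n)
    (fun i j h => add_le_add_right (hAmono h) 1) hbtop hconv
  have hsumeq : ∀ n, ∑ i ∈ Finset.range n, (1 + A (i + 1)) *
      ((1 / (1 + A (i + 1))) * (b i - (k (i + 1) - k i) * τ i)) = k n * y n - s₀ - A n := by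
    intro n
    induction n with
    | zero => simp [hA0, hs₀]
    | succ n ih =>
      rw [Finset.sum_range_succ, ih, hA, hstep, ← mul_assoc, mul_one_div_cancel (by
        rw [← hA]; exact (hApos _).ne')]
      ring
  simp_rw [hsumeq] at hkron
  -- Of the slack 1 - 1 / lam, one half absorbs the Kronecker error and the other the constant 1 in
  -- 1 + A.
  have hev : ∀ᶠ n in atTop, 1 + A n ≤ lam * (k n * y n) := by
    have h1 : 0 < 1 - 1 / lam := by
      rw [sub_pos, div_lt_one (by linarith)]
      exact hlam
    have h2 : -((1 - 1 / lam) / 2) < 0 := by linarith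
    filter_upwards [hkron.eventually (lt_mem_nhds h2),
      hbtop.eventually_ge_atTop (1 / ((1 - 1 / lam) / 2))] with n hn hn'
    rw [lt_div_iff₀ (hApos n)] at hn
    rw [div_le_iff₀ (by linarith)] at hn'
    have h3 : (1 + A n) / lam ≤ k n * y n := by
      have : (1 + A n) / lam = (1 + A n) - 2 * ((1 + A n) * ((1 - 1 / lam) / 2)) := by ring
      linarith
    rw [div_le_iff₀ (by linarith)] at h3
    linarith
  obtain ⟨n₀, hn₀⟩ := eventually_atTop.1 (hrep.and hev)
  -- The increment of A is (k (n + 1) - k n) * τ n with τ n ≥ (1 + A n) / k n, so 1 + A grows at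
  -- least proportionally to k.
  have hmono : ∀ n, n₀ ≤ n → (1 + A n₀) / k n₀ ≤ (1 + A n) / k n := by
    intro n hn
    induction n, hn using Nat.le_induction with
    | base => rfl
    | succ n hn ih =>
      obtain ⟨h1, h2⟩ := hn₀ n hn
      refine ih.trans ?_
      rw [div_le_div_iff₀ (hk0 n) (hk0 _), hA]
      have h3 : 1 + A n ≤ k n * τ n := by
        calc 1 + A n ≤ lam * (k n * y n) := h2
          _ = k n * (lam * y n) := by ring
          _ ≤ k n * τ n := mul_le_mul_of_nonneg_left h1 (hk0 n).le
      have := mul_le_mul_of_nonneg_left h3 (sub_nonneg.2 (hkmono n))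
      nlinarith
  intro hlim
  have hc : 0 < (1 + A n₀) / k n₀ := div_pos (hApos _) (hk0 _)
  have hge : ∀ᶠ n in atTop, (1 + A n₀) / k n₀ / lam ≤ y n := by
    filter_upwards [eventually_ge_atTop n₀] with n hn
    rw [div_le_iff₀ (by linarith)]
    refine (hmono n hn).trans ?_
    rw [div_le_iff₀ (hk0 n)]
    linarith [(hn₀ n hn).2]
  have := ge_of_tendsto hlim hge
  have : 0 < (1 + A n₀) / k n₀ / lam := div_pos hc (by linarith)
  linarith

/-! ### Martingales with square-summable increments -/

/-- Pull-out property in integrated form; it yields both the orthogonality of martingale increments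
and the second moment of a batch. -/
theorem integral_mul_eq_integral_mul_condExp {Ω : Type*} {m mΩ : MeasurableSpace Ω}
    {μ : Measure Ω} [IsProbabilityMeasure μ] (hm : m ≤ mΩ) {φ f : Ω → ℝ}
    (hφ : StronglyMeasurable[m] φ) {c : ℝ} (hc : ∀ᵐ ω ∂μ, |φ ω| ≤ c) (hf : Integrable f μ) :
    Integrable (fun ω => φ ω * f ω) μ ∧ Integrable (fun ω => φ ω * (μ[f | m]) ω) μ ∧
      ∫ ω, φ ω * f ω ∂μ = ∫ ω, φ ω * (μ[f | m]) ω ∂μ := by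
  have h1 : Integrable (fun ω => φ ω * f ω) μ :=
    hf.bdd_mul (hφ.mono hm).aestronglyMeasurable hc
  refine ⟨h1, integrable_condExp.bdd_mul (hφ.mono hm).aestronglyMeasurable hc, ?_⟩
  rw [← integral_condExp hm]
  exact integral_congr_ae (condExp_mul_of_stronglyMeasurable_left hφ h1 hf)

/-- Square-summable martingale differences are almost surely summable. -/
theorem ae_exists_tendsto_sum_of_condExp_eq_zero {Ω : Type*} {mΩ : MeasurableSpace Ω}
    {μ : Measure Ω} [IsProbabilityMeasure μ] {ℱ : Filtration ℕ mΩ} {D : ℕ → Ω → ℝ}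
    (hadp : ∀ n, StronglyMeasurable[ℱ (n + 1)] (D n))
    (hbdd : ∀ n, ∃ c, ∀ᵐ ω ∂μ, |D n ω| ≤ c) (hmean : ∀ n, μ[D n | ℱ n] =ᵐ[μ] 0) {K : ℝ}
    (hvar : ∀ n, ∑ i ∈ Finset.range n, ∫ ω, D i ω ^ 2 ∂μ ≤ K) :
    ∀ᵐ ω ∂μ, (∃ l, Tendsto (fun n => ∑ i ∈ Finset.range n, D i ω) atTop (𝓝 l)) ∧
      Summable fun n => D n ω ^ 2 := by
  have hDm : ∀ n, AEStronglyMeasurable (D n) μ :=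
    fun n => ((hadp n).mono (ℱ.le _)).aestronglyMeasurable
  have hDint : ∀ n, Integrable (D n) μ := fun n => by
    obtain ⟨c, hc⟩ := hbdd n
    exact Integrable.of_bound (hDm n) c hc
  have hD2int : ∀ n, Integrable (fun ω => D n ω ^ 2) μ := fun n => by
    obtain ⟨c, hc⟩ := hbdd n
    refine Integrable.of_bound ((hDm n).pow 2) (c ^ 2) ?_
    filter_upwards [hc] with ω h
    rw [Real.norm_eq_abs, abs_pow]
    gcongr
  set M : ℕ → Ω → ℝ := fun n ω => ∑ i ∈ Finset.range n, D i ω with hM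
  have hMsucc : ∀ n ω, M (n + 1) ω = M n ω + D n ω := fun n ω => Finset.sum_range_succ _ _
  have hMadp : ∀ n, StronglyMeasurable[ℱ n] (M n) := by
    intro n
    refine Finset.stronglyMeasurable_fun_sum _ fun i hi => ?_
    exact (hadp i).mono (ℱ.mono (Finset.mem_range.1 hi))
  have hMbdd : ∀ n, ∃ c, ∀ᵐ ω ∂μ, |M n ω| ≤ c := by
    choose c hc using hbdd
    intro n
    refine ⟨∑ i ∈ Finset.range n, c i, ?_⟩
    filter_upwards [ae_all_iff.2 hc] with ω h
    exact (Finset.abs_sum_le_sum_abs _ _).trans (Finset.sum_le_sum fun i _ => h i)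
  have hMint : ∀ n, Integrable (M n) μ := fun n => integrable_finsetSum _ fun i _ => hDint i
  -- The cross term M n * D n has mean zero, so second moments add up.
  have hM2 : ∀ n, Integrable (fun ω => M n ω ^ 2) μ ∧
      ∫ ω, M n ω ^ 2 ∂μ = ∑ i ∈ Finset.range n, ∫ ω, D i ω ^ 2 ∂μ := by
    intro n
    induction n with
    | zero => simp [hM]
    | succ n ih =>
      obtain ⟨c, hc⟩ := hMbdd n
      obtain ⟨h1, -, h2⟩ :=
        integral_mul_eq_integral_mul_condExp (ℱ.le n) (hMadp n) hc (hDint n)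
      have h3 : ∫ ω, M n ω * (μ[D n | ℱ n]) ω ∂μ = 0 := by
        rw [integral_congr_ae (g := fun _ => 0), integral_zero]
        filter_upwards [hmean n] with ω h
        simp [h]
      have h4 : (fun ω => M (n + 1) ω ^ 2) =
          fun ω => M n ω ^ 2 + 2 * (M n ω * D n ω) + D n ω ^ 2 := by
        ext ω
        rw [hMsucc]
        ring
      have h5 : Integrable (fun ω => M n ω ^ 2 + 2 * (M n ω * D n ω)) μ :=
        ih.1.add (h1.const_mul 2)
      rw [h4]
      refine ⟨h5.add (hD2int n), ?_⟩
      rw [integral_add h5 (hD2int n), integral_add ih.1 (h1.const_mul 2), integral_const_mul,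
        h2, h3, ih.2, Finset.sum_range_succ]
      ring
  have hmart : Martingale M ℱ μ := by
    refine martingale_of_condExp_sub_eq_zero_nat hMadp hMint fun n => ?_
    have : M (n + 1) - M n = D n := by
      ext ω
      simp [hMsucc]
    rw [this]
    exact hmean n
  have hL1 : ∀ n, eLpNorm (M n) 1 μ ≤ ((1 + K).toNNReal : ENNReal) := by
    intro n
    rw [eLpNorm_one_eq_lintegral_enorm, ← ofReal_integral_norm_eq_lintegral_enorm (hMint n)]
    refine ENNReal.ofReal_le_ofReal ?_
    calc ∫ ω, ‖M n ω‖ ∂μ ≤ ∫ ω, (1 + M n ω ^ 2) ∂μ := by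
          refine integral_mono (hMint n).norm ((integrable_const 1).add (hM2 n).1) fun ω => ?_
          simp only [Real.norm_eq_abs]
          nlinarith [sq_nonneg (|M n ω| - 1), sq_abs (M n ω)]
      _ ≤ 1 + K := by
          rw [integral_add (integrable_const 1) (hM2 n).1, (hM2 n).2]
          simpa using hvar n
  have hconv := hmart.submartingale.exists_ae_tendsto_of_bdd hL1
  have hsqm : ∀ n, AEMeasurable (fun ω => ENNReal.ofReal (D n ω ^ 2)) μ :=
    fun n => ((hDm n).pow 2).aemeasurable.ennreal_ofReal
  have hsq : ∫⁻ ω, ∑' n, ENNReal.ofReal (D n ω ^ 2) ∂μ ≠ ⊤ := by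
    rw [lintegral_tsum hsqm]
    refine ne_top_of_le_ne_top (ENNReal.ofReal_ne_top (r := K)) ?_
    refine ENNReal.tsum_le_of_sum_range_le fun n => ?_
    calc ∑ i ∈ Finset.range n, ∫⁻ ω, ENNReal.ofReal (D i ω ^ 2) ∂μ
        = ∑ i ∈ Finset.range n, ENNReal.ofReal (∫ ω, D i ω ^ 2 ∂μ) := by
          refine Finset.sum_congr rfl fun i _ => ?_
          rw [ofReal_integral_eq_lintegral_ofReal (hD2int i) (.of_forall fun ω => sq_nonneg _)]
      _ = ENNReal.ofReal (∑ i ∈ Finset.range n, ∫ ω, D i ω ^ 2 ∂μ) :=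
          (ENNReal.ofReal_sum_of_nonneg fun i _ => integral_nonneg fun ω => sq_nonneg _).symm
      _ ≤ ENNReal.ofReal K := ENNReal.ofReal_le_ofReal (hvar n)
  have hfin := ae_lt_top' (AEMeasurable.tsum hsqm) hsq
  filter_upwards [hconv, hfin] with ω h1 h2
  refine ⟨h1, ?_⟩
  have h3 := ENNReal.summable_toReal h2.ne
  refine h3.congr fun n => ?_
  exact ENNReal.toReal_ofReal (sq_nonneg _)

/-! ### Conditionally multinomial vectors -/

section multinomial

variable {G : Type*} [Fintype G] [DecidableEq G] {Ω : Type*} {m mΩ : MeasurableSpace Ω}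
  {μ : Measure Ω} [IsProbabilityMeasure μ] {β : Ω → G → ℕ} {N : Ω → ℕ} {M : ℕ}
  {t : Ω → EuclideanSpace ℝ G}

/-- Conditional binomial moments of a conditionally multinomial vector. -/
theorem condExp_choose_of_multinomial (hβ : ∀ x, MeasurableSet {ω | β ω = x})
    (hβN : ∀ ω, ∑ g, β ω g = N ω) (hN : ∀ᵐ ω ∂μ, N ω ≤ M) (ht : ∀ ω, ∑ g, t ω g = 1)
    (hmult : ∀ x : G → ℕ, μ[Set.indicator {ω | β ω = x} (fun _ => (1 : ℝ)) | m] =ᵐ[μ]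
      fun ω => multinomialProb (t ω) (N ω) x) (S : Finset G) (j : ℕ) :
    μ[fun ω => ((∑ g ∈ S, β ω g).choose j : ℝ) | m] =ᵐ[μ]
      fun ω => ((N ω).choose j : ℝ) * (∑ g ∈ S, t ω g) ^ j := by
  -- A finite box containing almost every value of β, so that the conditional expectation is a
  -- finite sum over point masses.
  set J : Finset (G → ℕ) := Fintype.piFinset fun _ => Finset.range (M + 1) with hJ
  have hsub : ∀ n ≤ M, Finset.piAntidiag Finset.univ n ⊆ J := by
    intro n hn x hx
    rw [hJ, Fintype.mem_piFinset]
    intro g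
    have h1 : ∑ g, x g = n := (Finset.mem_piAntidiag.1 hx).1
    have h2 : x g ≤ ∑ g, x g := Finset.single_le_sum (fun _ _ => Nat.zero_le _) (Finset.mem_univ g)
    rw [Finset.mem_range]
    omega
  have hf : (fun ω => ((∑ g ∈ S, β ω g).choose j : ℝ)) =ᵐ[μ]
      ∑ x ∈ J, ((∑ g ∈ S, x g).choose j : ℝ) •
        Set.indicator {ω | β ω = x} (fun _ => (1 : ℝ)) := by
    filter_upwards [hN] with ω hω
    have hmem : β ω ∈ J := hsub _ hω (by simp [Finset.mem_piAntidiag, hβN])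
    rw [Finset.sum_apply, Finset.sum_eq_single_of_mem _ hmem]
    · simp
    · intro x _ hx
      simp [Set.indicator, hx.symm]
  refine (condExp_congr_ae hf).trans ?_
  have hint : ∀ x, Integrable (Set.indicator {ω | β ω = x} (fun _ => (1 : ℝ))) μ :=
    fun x => (integrable_const 1).indicator (hβ x)
  refine (condExp_finsetSum (fun x _ => (hint x).smul _) m).trans ?_
  have h1 : ∀ x : G → ℕ, μ[((∑ g ∈ S, x g).choose j : ℝ) •
      Set.indicator {ω | β ω = x} (fun _ => (1 : ℝ)) | m] =ᵐ[μ]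
      fun ω => ((∑ g ∈ S, x g).choose j : ℝ) * multinomialProb (t ω) (N ω) x := by
    intro x
    refine (condExp_smul _ _ m).trans ?_
    filter_upwards [hmult x] with ω h
    simp [h]
  filter_upwards [hN, ae_all_iff.2 h1] with ω hω h
  rw [Finset.sum_apply, Finset.sum_congr rfl fun x _ => h x,
    ← sum_multinomialProb_mul_choose (ht ω)]
  refine (Finset.sum_subset (hsub _ hω) fun x _ hx => ?_).symm
  have : ¬ ∑ g, x g = N ω := fun h => hx (by simp [Finset.mem_piAntidiag, h])
  rw [multinomialProb, if_neg this, mul_zero]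

/-- Mean and variance of the weighted deviation of a conditionally multinomial vector. -/
theorem condExp_deviation_of_multinomial (hm : m ≤ mΩ) (hβ : ∀ x, MeasurableSet {ω | β ω = x})
    (hβN : ∀ ω, ∑ g, β ω g = N ω) (hNm : Measurable[m] N) (hN : ∀ᵐ ω ∂μ, N ω ≤ M)
    (htm : ∀ g, Measurable[m] fun ω => t ω g) (ht : ∀ ω, t ω ∈ simplex G)
    (hmult : ∀ x : G → ℕ, μ[Set.indicator {ω | β ω = x} (fun _ => (1 : ℝ)) | m] =ᵐ[μ]
      fun ω => multinomialProb (t ω) (N ω) x) (S : Finset G) {w : Ω → ℝ}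
    (hwm : Measurable[m] w) (hw : ∀ ω, |w ω| ≤ 1) :
    (∀ᵐ ω ∂μ, |w ω * (((∑ g ∈ S, β ω g : ℕ) : ℝ) - N ω * ∑ g ∈ S, t ω g)| ≤ 2 * M) ∧
    μ[fun ω => w ω * (((∑ g ∈ S, β ω g : ℕ) : ℝ) - N ω * ∑ g ∈ S, t ω g) | m] =ᵐ[μ] 0 ∧
    ∫ ω, (w ω * (((∑ g ∈ S, β ω g : ℕ) : ℝ) - N ω * ∑ g ∈ S, t ω g)) ^ 2 ∂μ ≤
      ∫ ω, w ω ^ 2 * (N ω * ∑ g ∈ S, t ω g) ∂μ := by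
  have hNr : Measurable[m] fun ω => (N ω : ℝ) := measurable_from_top.comp hNm
  set τ : Ω → ℝ := fun ω => ∑ g ∈ S, t ω g with hτ
  have hτm : Measurable[m] τ := Finset.measurable_fun_sum _ fun g _ => htm g
  have hτ0 : ∀ ω, 0 ≤ τ ω := fun ω => Finset.sum_nonneg fun g _ => (ht ω).1 g
  have hτ1 : ∀ ω, τ ω ≤ 1 := fun ω => by
    rw [← (ht ω).2]
    exact Finset.sum_le_univ_sum_of_nonneg (ht ω).1
  set b : Ω → ℕ := fun ω => ∑ g ∈ S, β ω g with hb
  have hβm : Measurable β := measurable_to_countable' hβ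
  have hbm : Measurable b :=
    (measurable_of_countable fun x : G → ℕ => ∑ g ∈ S, x g).comp hβm
  have hbN : ∀ ω, b ω ≤ N ω := fun ω => by
    rw [← hβN]
    exact Finset.sum_le_univ_sum_of_nonneg fun _ => Nat.zero_le _
  have hbr : Measurable fun ω => (b ω : ℝ) := measurable_from_top.comp hbm
  have hb2r : Measurable fun ω => ((b ω).choose 2 : ℝ) :=
    (measurable_from_top (f := fun n : ℕ => (n.choose 2 : ℝ))).comp hbm
  have hbint : Integrable (fun ω => (b ω : ℝ)) μ := by
    refine Integrable.of_bound hbr.aestronglyMeasurable (M : ℝ) ?_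
    filter_upwards [hN] with ω h
    simpa using (hbN ω).trans h
  have hb2int : Integrable (fun ω => ((b ω).choose 2 : ℝ)) μ := by
    refine Integrable.of_bound hb2r.aestronglyMeasurable (M.choose 2 : ℝ) ?_
    filter_upwards [hN] with ω h
    simpa using Nat.choose_le_choose 2 ((hbN ω).trans h)
  have hmean : μ[fun ω => (b ω : ℝ) | m] =ᵐ[μ] fun ω => (N ω : ℝ) * τ ω := by
    simpa [hb, hτ] using condExp_choose_of_multinomial hβ hβN hN (fun ω => (ht ω).2) hmult S 1
  have hmean2 : μ[fun ω => ((b ω).choose 2 : ℝ) | m] =ᵐ[μ]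
      fun ω => ((N ω).choose 2 : ℝ) * τ ω ^ 2 :=
    condExp_choose_of_multinomial hβ hβN hN (fun ω => (ht ω).2) hmult S 2
  have hNτ : ∀ ω, 0 ≤ N ω * τ ω ∧ N ω * τ ω ≤ N ω := fun ω =>
    ⟨mul_nonneg (Nat.cast_nonneg _) (hτ0 ω), mul_le_of_le_one_right (Nat.cast_nonneg _) (hτ1 ω)⟩
  have hNMr : ∀ᵐ ω ∂μ, (N ω : ℝ) ≤ M := hN.mono fun ω h => by exact_mod_cast h
  have hdev : ∀ ω, |(b ω : ℝ) - N ω * τ ω| ≤ N ω := fun ω => by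
    have h1 : (b ω : ℝ) ≤ N ω := by exact_mod_cast hbN ω
    have h2 : (0 : ℝ) ≤ b ω := Nat.cast_nonneg _
    rw [abs_le]
    constructor <;> linarith [hNτ ω]
  have hw2 : ∀ ω, w ω ^ 2 ≤ 1 := fun ω => (sq_le_one_iff_abs_le_one _).2 (hw ω)
  refine ⟨?_, ?_, ?_⟩
  · filter_upwards [hNMr] with ω h
    rw [abs_mul]
    have h1 := hdev ω
    have h2 : (0 : ℝ) ≤ N ω := Nat.cast_nonneg _
    nlinarith [abs_nonneg ((b ω : ℝ) - N ω * τ ω), hw ω]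
  · have hcm : StronglyMeasurable[m] fun ω => w ω * (N ω * τ ω) :=
      (hwm.mul (hNr.mul hτm)).stronglyMeasurable
    have hcint : Integrable (fun ω => w ω * (N ω * τ ω)) μ := by
      refine Integrable.of_bound (hcm.mono hm).aestronglyMeasurable (M : ℝ) ?_
      filter_upwards [hNMr] with ω h
      rw [norm_mul, Real.norm_eq_abs, Real.norm_of_nonneg (hNτ ω).1]
      nlinarith [hw ω, hNτ ω, abs_nonneg (w ω)]
    have hwb : Integrable ((fun ω => w ω) * fun ω => (b ω : ℝ)) μ :=
      hbint.bdd_mul (hwm.stronglyMeasurable.mono hm).aestronglyMeasurable (.of_forall hw)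
    have h1 : (fun ω => w ω * ((b ω : ℝ) - N ω * τ ω)) =
        ((fun ω => w ω) * fun ω => (b ω : ℝ)) - fun ω => w ω * (N ω * τ ω) := by
      ext ω
      simp [mul_sub]
    rw [h1]
    refine (condExp_sub hwb hcint m).trans ?_
    rw [condExp_of_stronglyMeasurable hm hcm hcint]
    filter_upwards [condExp_mul_of_stronglyMeasurable_left hwm.stronglyMeasurable hwb hbint,
      hmean] with ω h2 h3
    simp [h2, h3]
  · set φ₁ : Ω → ℝ := fun ω => 2 * w ω ^ 2 with hφ₁
    set φ₂ : Ω → ℝ := fun ω => w ω ^ 2 * (1 - 2 * (N ω * τ ω)) with hφ₂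
    set φ₃ : Ω → ℝ := fun ω => w ω ^ 2 * (N ω * τ ω) ^ 2 with hφ₃
    have hφ₁m : Measurable[m] φ₁ := (hwm.pow_const 2).const_mul 2
    have hφ₂m : Measurable[m] φ₂ :=
      (hwm.pow_const 2).mul (measurable_const.sub ((hNr.mul hτm).const_mul 2))
    have hφ₃m : Measurable[m] φ₃ := (hwm.pow_const 2).mul ((hNr.mul hτm).pow_const 2)
    obtain ⟨i1, i1', e1⟩ := integral_mul_eq_integral_mul_condExp (c := 2) hm
      hφ₁m.stronglyMeasurable (.of_forall fun ω => by
        rw [abs_of_nonneg (by positivity)]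
        linarith [hw2 ω]) hb2int
    obtain ⟨i2, i2', e2⟩ := integral_mul_eq_integral_mul_condExp (c := 1 + 2 * M) hm
      hφ₂m.stronglyMeasurable (by
        filter_upwards [hNMr] with ω h
        have h1 : |1 - 2 * (N ω * τ ω)| ≤ 1 + 2 * M := by
          rw [abs_le]
          constructor <;> linarith [hNτ ω]
        rw [abs_mul, abs_of_nonneg (sq_nonneg (w ω))]
        calc w ω ^ 2 * |1 - 2 * (N ω * τ ω)| ≤ 1 * |1 - 2 * (N ω * τ ω)| := by
              gcongr
              exact hw2 ω
          _ ≤ 1 + 2 * M := by linarith) hbint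
    have i3 : Integrable φ₃ μ := by
      refine Integrable.of_bound (hφ₃m.mono hm le_rfl).aestronglyMeasurable ((M : ℝ) ^ 2) ?_
      filter_upwards [hNMr] with ω h
      rw [Real.norm_of_nonneg (by positivity)]
      calc w ω ^ 2 * (N ω * τ ω) ^ 2 ≤ 1 * (M : ℝ) ^ 2 := by
            gcongr
            · exact hw2 ω
            · exact (hNτ ω).1
            · exact (hNτ ω).2.trans h
        _ = (M : ℝ) ^ 2 := one_mul _
    have i4 : Integrable (fun ω => w ω ^ 2 * (N ω * τ ω)) μ := by
      refine Integrable.of_bound (((hwm.pow_const 2).mul (hNr.mul hτm)).mono hm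
        le_rfl).aestronglyMeasurable (M : ℝ) ?_
      filter_upwards [hNMr] with ω h
      rw [Real.norm_of_nonneg (mul_nonneg (sq_nonneg _) (hNτ ω).1)]
      calc w ω ^ 2 * (N ω * τ ω) ≤ 1 * (M : ℝ) := by
            gcongr
            · exact (hNτ ω).1
            · exact hw2 ω
            · exact (hNτ ω).2.trans h
        _ = (M : ℝ) := one_mul _
    -- From b² = 2 * b.choose 2 + b, so that only the first two binomial moments are needed.
    have hexp : (fun ω => (w ω * ((b ω : ℝ) - N ω * τ ω)) ^ 2) =
        fun ω => φ₁ ω * ((b ω).choose 2 : ℝ) + φ₂ ω * (b ω : ℝ) + φ₃ ω := by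
      ext ω
      simp only [hφ₁, hφ₂, hφ₃, Nat.cast_choose_two]
      ring
    have i12 : Integrable (fun ω => φ₁ ω * ((b ω).choose 2 : ℝ) + φ₂ ω * (b ω : ℝ)) μ := i1.add i2
    have i12' : Integrable (fun ω => φ₁ ω * (μ[fun ω => ((b ω).choose 2 : ℝ) | m]) ω +
        φ₂ ω * (μ[fun ω => (b ω : ℝ) | m]) ω) μ := i1'.add i2'
    rw [hexp, integral_add i12 i3, integral_add i1 i2, e1, e2, ← integral_add i1' i2',
      ← integral_add i12' i3]
    refine integral_mono_ae (i12'.add i3) i4 ?_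
    filter_upwards [hmean, hmean2] with ω h1 h2
    rw [h1, h2, Nat.cast_choose_two]
    change _ ≤ w ω ^ 2 * (N ω * τ ω)
    simp only [hφ₁, hφ₂, hφ₃]
    -- The exact conditional variance is w² N τ (1 - τ); this is the term discarded.
    have : 0 ≤ w ω ^ 2 * (N ω * τ ω ^ 2) := by positivity
    nlinarith

end multinomial

/-! ### Measurability and the simplex -/

/-- Lets sums over a random range of draws be treated one fixed range at a time. -/
theorem measurable_apply_of_countable_index {Ω ι α : Type*} [MeasurableSpace Ω] [Countable ι]
    [MeasurableSpace ι] [MeasurableSingletonClass ι] [MeasurableSpace α] {f : ι → Ω → α}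
    (hf : ∀ i, Measurable (f i)) {i : Ω → ι} (hi : Measurable i) :
    Measurable fun ω => f (i ω) ω :=
  (measurable_from_prod_countable_right (f := fun x : ι × Ω => f x.1 x.2) hf).comp
    (hi.prodMk measurable_id)

theorem isClosed_simplex (G : Type*) [Fintype G] : IsClosed (simplex G) := by
  refine IsClosed.and ?_ (isClosed_eq (by fun_prop) continuous_const)
  simp only [Set.ofPred_forall]
  exact isClosed_iInter fun g => isClosed_le continuous_const (by fun_prop)

theorem apply_le_one_of_mem_simplex {G : Type*} [Fintype G] {p : EuclideanSpace ℝ G}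
    (hp : p ∈ simplex G) (g : G) : p g ≤ 1 := by
  rw [← hp.2]
  exact Finset.single_le_sum (fun g _ => hp.1 g) (Finset.mem_univ g)

theorem isCompact_simplex (G : Type*) [Fintype G] : IsCompact (simplex G) := by
  refine Metric.isCompact_of_isClosed_isBounded (isClosed_simplex G)
    ((Metric.isBounded_closedBall (x := 0) (r := 1)).subset fun p hp => ?_)
  rw [mem_closedBall_zero_iff, ← sq_le_one_iff₀ (norm_nonneg _), EuclideanSpace.real_norm_sq_eq]
  calc ∑ g, p g ^ 2 ≤ ∑ g, p g :=
        Finset.sum_le_sum fun g _ => by nlinarith [hp.1 g, apply_le_one_of_mem_simplex hp g]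
    _ = 1 := hp.2

/-! ### The urn process and its filtration -/

section urn

variable {G Ω : Type*} {k : ℕ → Ω → ℕ} {X : ℕ → Ω → G}

theorem measurable_draw_urnSigma (n : ℕ) {i : ℕ} (hi : 1 ≤ i) :
    Measurable[urnSigma k X n, ⊤] fun ω => if i ≤ k n ω then some (X i ω) else none := by
  refine measurable_iff_comap_le.2 (le_sup_of_le_left ?_)
  exact le_iSup₂_of_le i hi le_rfl

theorem measurable_count_urnSigma {k₀ : ℕ} (hkinit : ∀ ω, k 0 ω = k₀) {n j : ℕ}
    (hj : j ≤ n + 1) : Measurable[urnSigma k X n] (k j) := by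
  rcases Nat.eq_zero_or_pos j with rfl | hj0
  · have : k 0 = fun _ => k₀ := funext hkinit
    rw [this]
    exact measurable_const
  · refine measurable_iff_comap_le.2 (le_sup_of_le_right ?_)
    exact le_iSup₂_of_le j (Finset.mem_Icc.2 ⟨hj0, hj⟩) le_rfl

theorem urnSigma_mono_succ {k₀ : ℕ} (hkinit : ∀ ω, k 0 ω = k₀)
    (hkmono : ∀ n ω, k n ω + 1 ≤ k (n + 1) ω) (n : ℕ) :
    urnSigma k X n ≤ urnSigma k X (n + 1) := by
  refine sup_le (iSup₂_le fun i hi => ?_) (iSup₂_le fun j hj => ?_)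
  · rw [← measurable_iff_comap_le]
    -- The earlier record is the later one truncated again at k n, which the later σ-algebra knows.
    have heq : (fun ω => if i ≤ k n ω then some (X i ω) else none) = fun ω =>
        if i ≤ k n ω then (if i ≤ k (n + 1) ω then some (X i ω) else none) else none := by
      ext1 ω
      have := hkmono n ω
      split_ifs with h1 h2
      · rfl
      · omega
      · rfl
    rw [heq]
    let _ : MeasurableSpace (Option G) := ⊤
    refine Measurable.ite ?_ (measurable_draw_urnSigma (n + 1) hi) measurable_const
    exact measurable_count_urnSigma hkinit (by omega) (measurableSet_Ici (a := i))
  · rw [← measurable_iff_comap_le]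
    exact measurable_count_urnSigma hkinit (by have := (Finset.mem_Icc.1 hj).2; omega)

theorem urnSigma_le [mΩ : MeasurableSpace Ω] (hkmeas : ∀ n, Measurable (k n))
    (hXmeas : ∀ i, Measurable[mΩ, ⊤] (X i)) (n : ℕ) : urnSigma k X n ≤ mΩ := by
  refine sup_le (iSup₂_le fun i _ => ?_) (iSup₂_le fun j _ => ?_)
  · rw [← measurable_iff_comap_le]
    let _ : MeasurableSpace (Option G) := ⊤
    refine Measurable.ite (hkmeas n (measurableSet_Ici (a := i))) ?_ measurable_const
    exact (@measurable_from_top _ _ ⊤ some).comp (hXmeas i)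
  · exact measurable_iff_comap_le.1 (hkmeas j)

/-- The natural filtration of the urn, started after the first batch. -/
def urnFiltration [mΩ : MeasurableSpace Ω] {k₀ : ℕ} (hkinit : ∀ ω, k 0 ω = k₀)
    (hkmeas : ∀ n, Measurable (k n)) (hkmono : ∀ n ω, k n ω + 1 ≤ k (n + 1) ω)
    (hXmeas : ∀ i, Measurable[mΩ, ⊤] (X i)) : Filtration ℕ mΩ where
  seq n := urnSigma k X (n + 1)
  mono' := monotone_nat_of_le_succ fun n => urnSigma_mono_succ hkinit hkmono (n + 1)
  le' n := urnSigma_le hkmeas hXmeas (n + 1)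

theorem count_pos {k₀ : ℕ} (hkinit : ∀ ω, k 0 ω = k₀) (hk₀ : 0 < k₀)
    (hkmono : ∀ n ω, k n ω + 1 ≤ k (n + 1) ω) (n : ℕ) (ω : Ω) : 0 < k n ω := by
  cases n with
  | zero => rwa [hkinit]
  | succ n => have := hkmono n ω; omega

/-- Iterating the ratio bound gives k n ≤ C ^ n * k₀; this makes each batch bounded, hence
integrable. -/
theorem exists_ae_count_le [mΩ : MeasurableSpace Ω] {μ : Measure Ω} {k₀ : ℕ}
    (hkinit : ∀ ω, k 0 ω = k₀) (hk₀ : 0 < k₀) (hkmono : ∀ n ω, k n ω + 1 ≤ k (n + 1) ω) {C : ℝ}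
    (hC : 1 < C) (hA3 : ∀ᵐ ω ∂μ, ∀ n, (k (n + 1) ω : ℝ) / (k n ω : ℝ) ≤ C) (n : ℕ) :
    ∃ M : ℕ, ∀ᵐ ω ∂μ, k n ω ≤ M := by
  refine ⟨⌊C ^ n * k₀⌋₊, ?_⟩
  filter_upwards [hA3] with ω hω
  refine Nat.le_floor ?_
  induction n with
  | zero => simp [hkinit]
  | succ n ih =>
    have h1 := hω n
    rw [div_le_iff₀ (by exact_mod_cast count_pos hkinit hk₀ hkmono n ω)] at h1
    refine h1.trans ?_
    rw [pow_succ, mul_comm (C ^ n) C, mul_assoc]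
    exact mul_le_mul_of_nonneg_left ih (by linarith)

variable [DecidableEq G]

theorem batchSum_apply (n : ℕ) (ω : Ω) (g : G) :
    batchSum k X n ω g =
      ∑ i ∈ Finset.Ioc (k n ω) (k (n + 1) ω), if X i ω = g then 1 else 0 := by
  rw [batchSum, Finset.sum_apply]
  refine Finset.sum_congr rfl fun i _ => ?_
  rw [Pi.single_apply]
  simp only [eq_comm]

theorem sum_batchSum [Fintype G] (n : ℕ) (ω : Ω) :
    ∑ g, batchSum k X n ω g = k (n + 1) ω - k n ω := by
  simp_rw [batchSum_apply]
  rw [Finset.sum_comm]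
  simp

theorem measurable_batchSum {k₀ : ℕ} (hkinit : ∀ ω, k 0 ω = k₀) (n : ℕ) (g : G) :
    Measurable[urnSigma k X (n + 1)] fun ω => batchSum k X n ω g := by
  -- Draws enter only through their truncated records; the truncation is inactive for i ≤ k (n + 1).
  let f : ℕ × ℕ → Ω → ℕ := fun x ω => ∑ i ∈ Finset.Ioc x.1 x.2,
    if (if i ≤ k (n + 1) ω then some (X i ω) else none) = some g then 1 else 0
  have hf : ∀ x, Measurable[urnSigma k X (n + 1)] (f x) := by
    intro x
    refine Finset.measurable_fun_sum _ fun i hi => ?_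
    have hi1 : 1 ≤ i := by
      have := (Finset.mem_Ioc.1 hi).1
      omega
    refine Measurable.ite ?_ measurable_const measurable_const
    exact measurable_draw_urnSigma (k := k) (X := X) (n + 1) hi1
      (show MeasurableSet[⊤] {some g} from trivial)
  have heq : (fun ω => batchSum k X n ω g) = fun ω => f (k n ω, k (n + 1) ω) ω := by
    ext1 ω
    rw [batchSum_apply]
    refine Finset.sum_congr rfl fun i hi => ?_
    simp [(Finset.mem_Ioc.1 hi).2]
  rw [heq]
  exact @measurable_apply_of_countable_index Ω (ℕ × ℕ) ℕ (urnSigma k X (n + 1)) _ _ _ _ f hf _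
    ((measurable_count_urnSigma hkinit (by omega)).prodMk
      (measurable_count_urnSigma hkinit (by omega)))

theorem empirical_succ_apply (p₀ : EuclideanSpace ℝ G) (n : ℕ) (ω : Ω) (g : G) :
    empirical k X p₀ (n + 1) ω g =
      (k n ω : ℝ) / (k (n + 1) ω : ℝ) * empirical k X p₀ n ω g +
        1 / (k (n + 1) ω : ℝ) * (batchSum k X n ω g : ℝ) := by
  simp [empirical]

theorem measurable_empirical_apply {k₀ : ℕ} (hkinit : ∀ ω, k 0 ω = k₀)
    (hkmono : ∀ n ω, k n ω + 1 ≤ k (n + 1) ω) (p₀ : EuclideanSpace ℝ G) (n : ℕ) (g : G) :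
    Measurable[urnSigma k X n] fun ω => empirical k X p₀ n ω g := by
  induction n with
  | zero =>
    simp only [empirical]
    exact measurable_const
  | succ n ih =>
    simp_rw [empirical_succ_apply]
    have h1 : Measurable[urnSigma k X (n + 1)] fun ω => (k n ω : ℝ) :=
      measurable_from_top.comp (measurable_count_urnSigma hkinit (by omega))
    have h2 : Measurable[urnSigma k X (n + 1)] fun ω => (k (n + 1) ω : ℝ) :=
      measurable_from_top.comp (measurable_count_urnSigma hkinit (by omega))
    have h3 : Measurable[urnSigma k X (n + 1)] fun ω => (batchSum k X n ω g : ℝ) :=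
      measurable_from_top.comp (measurable_batchSum hkinit n g)
    exact ((h1.div h2).mul (ih.mono (urnSigma_mono_succ hkinit hkmono n) le_rfl)).add
      ((measurable_const.div h2).mul h3)

theorem empirical_mem_simplex [Fintype G] {k₀ : ℕ} (hkinit : ∀ ω, k 0 ω = k₀) (hk₀ : 0 < k₀)
    (hkmono : ∀ n ω, k n ω + 1 ≤ k (n + 1) ω) {p₀ : EuclideanSpace ℝ G} (hp₀ : p₀ ∈ simplex G)
    (n : ℕ) (ω : Ω) : empirical k X p₀ n ω ∈ simplex G := by
  induction n with
  | zero => exact hp₀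
  | succ n ih =>
    refine ⟨fun g => ?_, ?_⟩
    · rw [empirical_succ_apply]
      have := ih.1 g
      positivity
    · simp_rw [empirical_succ_apply]
      rw [Finset.sum_add_distrib, ← Finset.mul_sum, ← Finset.mul_sum, ih.2, ← Nat.cast_sum,
        sum_batchSum, Nat.cast_sub (by have := hkmono n ω; omega)]
      have : (k (n + 1) ω : ℝ) ≠ 0 := by
        exact_mod_cast (count_pos hkinit hk₀ hkmono (n + 1) ω).ne'
      field_simp
      ring

theorem measurable_map_empirical_apply [Fintype G] {k₀ : ℕ} (hkinit : ∀ ω, k 0 ω = k₀)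
    (hk₀ : 0 < k₀) (hkmono : ∀ n ω, k n ω + 1 ≤ k (n + 1) ω) {p₀ : EuclideanSpace ℝ G}
    (hp₀ : p₀ ∈ simplex G) {T : EuclideanSpace ℝ G → EuclideanSpace ℝ G}
    (hT : ContinuousOn T (simplex G)) (n : ℕ) (g : G) :
    Measurable[urnSigma k X n] fun ω => T (empirical k X p₀ n ω) g := by
  classical
  -- T is controlled only on the simplex, so it is replaced by 0 outside, where the process never
  -- goes.
  have h1 : Measurable ((simplex G).piecewise T 0) :=
    hT.measurable_piecewise continuousOn_const (isClosed_simplex G).measurableSet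
  have h2 : Measurable[urnSigma k X n] fun ω => empirical k X p₀ n ω := by
    have h3 : Measurable[urnSigma k X n] fun ω => (empirical k X p₀ n ω).ofLp :=
      (@measurable_pi_iff _ _ _ (urnSigma k X n) _ _).2 fun g =>
        measurable_empirical_apply hkinit hkmono p₀ n g
    exact (by fun_prop : Measurable (WithLp.toLp 2 : (G → ℝ) → EuclideanSpace ℝ G)).comp h3
  have heq : (fun ω => T (empirical k X p₀ n ω) g) =
      fun ω => ((simplex G).piecewise T 0 (empirical k X p₀ n ω)) g := by
    ext1 ω
    rw [Set.piecewise_eq_of_mem _ _ _ (empirical_mem_simplex hkinit hk₀ hkmono hp₀ n ω)]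
  rw [heq]
  have h4 : Measurable fun p : EuclideanSpace ℝ G => p g := by fun_prop
  exact h4.comp (h1.comp h2)

/-- Predictably weighted deviations of the batches from their conditional means have almost surely
convergent sums, provided that their conditional variances have bounded sums. -/
theorem ae_tendsto_sum_deviation [Fintype G] [mΩ : MeasurableSpace Ω] {μ : Measure Ω}
    [IsProbabilityMeasure μ] {T : EuclideanSpace ℝ G → EuclideanSpace ℝ G}
    (hTmaps : Set.MapsTo T (simplex G) (simplex G)) (hTcont : ContinuousOn T (simplex G))
    {p₀ : EuclideanSpace ℝ G} (hp₀ : p₀ ∈ simplex G) {k₀ : ℕ} (hk₀ : 0 < k₀)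
    (hkinit : ∀ ω, k 0 ω = k₀) (hkmeas : ∀ n, Measurable (k n))
    (hkmono : ∀ n ω, k n ω + 1 ≤ k (n + 1) ω) (hXmeas : ∀ i, Measurable[mΩ, ⊤] (X i))
    (hmult : ∀ n ≥ 1, ∀ m : G → ℕ,
      μ[Set.indicator {ω | batchSum k X n ω = m} (fun _ => (1 : ℝ)) | urnSigma k X n] =ᵐ[μ]
        fun ω => multinomialProb (T (empirical k X p₀ n ω)) (k (n + 1) ω - k n ω) m)
    (hkbdd : ∀ n, ∃ M : ℕ, ∀ᵐ ω ∂μ, k n ω ≤ M) (S : Finset G) {w : ℕ → Ω → ℝ}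
    (hwm : ∀ n, Measurable[urnSigma k X (n + 1)] (w n)) (hw : ∀ n ω, |w n ω| ≤ 1) {K : ℝ}
    (hK : ∀ n ω, ∑ i ∈ Finset.range n, w i ω ^ 2 *
      (((k (i + 2) ω - k (i + 1) ω : ℕ) : ℝ) *
        ∑ g ∈ S, T (empirical k X p₀ (i + 1) ω) g) ≤ K) :
    ∀ᵐ ω ∂μ,
      (∃ l, Tendsto (fun n => ∑ i ∈ Finset.range n, w i ω *
        (((∑ g ∈ S, batchSum k X (i + 1) ω g : ℕ) : ℝ) - ((k (i + 2) ω - k (i + 1) ω : ℕ) : ℝ) *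
          ∑ g ∈ S, T (empirical k X p₀ (i + 1) ω) g)) atTop (𝓝 l)) ∧
      Summable fun n => (w n ω *
        (((∑ g ∈ S, batchSum k X (n + 1) ω g : ℕ) : ℝ) - ((k (n + 2) ω - k (n + 1) ω : ℕ) : ℝ) *
          ∑ g ∈ S, T (empirical k X p₀ (n + 1) ω) g)) ^ 2 := by
  have hle := urnSigma_le hkmeas hXmeas
  have hTsimp : ∀ n ω, T (empirical k X p₀ n ω) ∈ simplex G := fun n ω =>
    hTmaps (empirical_mem_simplex hkinit hk₀ hkmono hp₀ n ω)
  have hTm := measurable_map_empirical_apply (X := X) hkinit hk₀ hkmono hp₀ hTcont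
  have hcnt : ∀ n : ℕ, Measurable[urnSigma k X n] fun ω => k (n + 1) ω - k n ω := fun n =>
    (measurable_count_urnSigma hkinit le_rfl).sub (measurable_count_urnSigma hkinit (by omega))
  have hbatch : ∀ n x, MeasurableSet {ω | batchSum k X n ω = x} := by
    intro n x
    have : Measurable (batchSum k X n) := measurable_pi_iff.2 fun g =>
      (measurable_batchSum hkinit n g).mono (hle (n + 1)) le_rfl
    exact this (measurableSet_singleton x)
  choose M hM using hkbdd
  have hdev := fun n => condExp_deviation_of_multinomial (μ := μ) (M := M (n + 2)) (hle (n + 1))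
    (hbatch (n + 1)) (sum_batchSum (n + 1)) (hcnt (n + 1))
    ((hM (n + 2)).mono fun ω h => (Nat.sub_le _ _).trans h) (hTm (n + 1)) (hTsimp (n + 1))
    (hmult (n + 1) (by omega)) S (hwm n) (hw n)
  have hvm : ∀ i, Measurable[urnSigma k X (i + 1)] fun ω => w i ω ^ 2 *
      (((k (i + 2) ω - k (i + 1) ω : ℕ) : ℝ) *
        ∑ g ∈ S, T (empirical k X p₀ (i + 1) ω) g) := fun i =>
    ((hwm i).pow_const 2).mul (((measurable_from_top (f := fun n : ℕ => (n : ℝ))).comp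
      (hcnt (i + 1))).mul (Finset.measurable_fun_sum _ fun g _ => hTm (i + 1) g))
  have hv0 : ∀ i ω, 0 ≤ w i ω ^ 2 * (((k (i + 2) ω - k (i + 1) ω : ℕ) : ℝ) *
        ∑ g ∈ S, T (empirical k X p₀ (i + 1) ω) g) := fun i ω =>
    mul_nonneg (sq_nonneg _) (mul_nonneg (Nat.cast_nonneg _)
      (Finset.sum_nonneg fun g _ => (hTsimp (i + 1) ω).1 g))
  have hvint : ∀ i, Integrable (fun ω => w i ω ^ 2 *
      (((k (i + 2) ω - k (i + 1) ω : ℕ) : ℝ) *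
        ∑ g ∈ S, T (empirical k X p₀ (i + 1) ω) g)) μ := by
    intro i
    refine Integrable.of_bound ((hvm i).mono (hle _) le_rfl).aestronglyMeasurable K
      (.of_forall fun ω => ?_)
    rw [Real.norm_of_nonneg (hv0 i ω)]
    refine le_trans ?_ (hK (i + 1) ω)
    exact Finset.single_le_sum (f := fun i => w i ω ^ 2 *
      (((k (i + 2) ω - k (i + 1) ω : ℕ) : ℝ) *
        ∑ g ∈ S, T (empirical k X p₀ (i + 1) ω) g)) (fun j _ => hv0 j ω)
      (Finset.self_mem_range_succ i)
  refine ae_exists_tendsto_sum_of_condExp_eq_zero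
    (ℱ := urnFiltration hkinit hkmeas hkmono hXmeas) (K := K) ?_ (fun n => ⟨_, (hdev n).1⟩)
    (fun n => (hdev n).2.1) ?_
  · intro n
    have hmono := urnSigma_mono_succ (X := X) hkinit hkmono (n + 1)
    refine Measurable.stronglyMeasurable ?_
    refine ((hwm n).mono hmono le_rfl).mul (Measurable.sub ?_ (Measurable.mul ?_ ?_))
    · exact measurable_from_top.comp
        (Finset.measurable_fun_sum _ fun g _ => measurable_batchSum hkinit (n + 1) g)
    · exact measurable_from_top.comp ((hcnt (n + 1)).mono hmono le_rfl)
    · exact Finset.measurable_fun_sum _ fun g _ => (hTm (n + 1) g).mono hmono le_rfl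
  · intro n
    refine (Finset.sum_le_sum fun i _ => (hdev i).2.2).trans ?_
    rw [← integral_finsetSum _ fun i _ => hvint i]
    calc _ ≤ ∫ _, K ∂μ := integral_mono (integrable_finsetSum _ fun i _ => hvint i)
          (integrable_const K) (hK n)
      _ = K := by simp

end urn

/-! ### Lyapunov argument -/

/-- If the steps were summable, they would tend to 0 and eventually twice the step would bound the
increment of log k, so log k would converge. -/
theorem not_summable_one_sub_div_succ {k : ℕ → ℝ} (hk0 : ∀ n, 0 < k n)
    (hkmono : ∀ n, k n ≤ k (n + 1)) (hktop : Tendsto k atTop atTop) :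
    ¬ Summable fun n => 1 - k n / k (n + 1) := by
  intro h
  have hlog : Summable fun n => Real.log (k (n + 1)) - Real.log (k n) := by
    refine (h.mul_left 2).of_norm_bounded_eventually_nat ?_
    filter_upwards [h.tendsto_atTop_zero.eventually_lt_const (by norm_num : (0 : ℝ) < 1 / 2)]
      with n hn
    have h1 : 1 / 2 < k n / k (n + 1) := by linarith
    rw [lt_div_iff₀ (hk0 _)] at h1
    rw [Real.norm_of_nonneg (sub_nonneg.2 (Real.log_le_log (hk0 n) (hkmono n))),
      ← Real.log_div (hk0 _).ne' (hk0 _).ne']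
    refine (Real.log_le_sub_one_of_pos (div_pos (hk0 _) (hk0 _))).trans ?_
    have h2 : k (n + 1) / k n - 1 = (k (n + 1) - k n) / k n := by
      have := (hk0 n).ne'
      field_simp
    have h3 : 2 * (1 - k n / k (n + 1)) = 2 * (k (n + 1) - k n) / k (n + 1) := by
      have := (hk0 (n + 1)).ne'
      field_simp
    rw [h2, h3, div_le_div_iff₀ (hk0 _) (hk0 _)]
    nlinarith [hkmono n]
  have h1 := hlog.hasSum.tendsto_sum_nat
  simp_rw [Finset.sum_range_sub fun n => Real.log (k n)] at h1
  exact not_tendsto_nhds_of_tendsto_atTop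
    (tendsto_atTop_add_const_right _ _ (Real.tendsto_log_atTop.comp hktop)) _ h1

/-- A perturbed averaging scheme for a contracting map of the simplex converges to a fixed point
if the perturbations have convergent sums, also against the deviation of the scheme from `q₀`. -/
theorem exists_tendsto_fixedPt_of_perturbation {G : Type*} [Fintype G]
    {T : EuclideanSpace ℝ G → EuclideanSpace ℝ G} (hTcont : ContinuousOn T (simplex G))
    {q₀ : EuclideanSpace ℝ G} (hA1 : ConditionA1 T q₀) {x : ℕ → EuclideanSpace ℝ G}
    (hx : ∀ n, x n ∈ simplex G) {a : ℕ → ℝ} (ha0 : ∀ n, 0 ≤ a n) (ha1 : ∀ n, a n ≤ 1)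
    (ha : ¬ Summable a) {ξ : ℕ → G → ℝ}
    (hstep : ∀ n g, x (n + 1) g = x n g + a n * (T (x n) g - x n g) + ξ n g)
    (hξ : ∀ g, ∃ l, Tendsto (fun n => ∑ i ∈ Finset.range n, ξ i g) atTop (𝓝 l))
    (hξ2 : ∀ g, Summable fun n => ξ n g ^ 2)
    (hcross : ∀ g, ∃ l, Tendsto (fun n => ∑ i ∈ Finset.range n,
      (x i g + a i * (T (x i) g - x i g) - q₀ g) * ξ i g) atTop (𝓝 l)) :
    ∃ q ∈ fixedPts T, Tendsto x atTop (𝓝 q) := by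
  set D : EuclideanSpace ℝ G → ℝ := fun p => ‖p - q₀‖ ^ 2 - ‖T p - q₀‖ ^ 2 with hD
  have hDpos : ∀ p ∈ simplex G, p ∉ fixedPts T → 0 < D p := fun p hp hpf => by
    have := hA1.contracting p hp hpf
    simp only [hD]
    nlinarith [norm_nonneg (T p - q₀), norm_nonneg (p - q₀)]
  have hDfix : ∀ p ∈ simplex G, D p = 0 → p ∈ fixedPts T := fun p hp h0 => by
    by_contra hpf
    exact (hDpos p hp hpf).ne' h0
  have hDnonneg : ∀ p ∈ simplex G, 0 ≤ D p := fun p hp => by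
    by_cases hpf : p ∈ fixedPts T
    · simp [hD, hpf.2]
    · exact (hDpos p hp hpf).le
  have hDcont : ContinuousOn D (simplex G) :=
    ((continuousOn_id.sub continuousOn_const).norm.pow 2).sub
      ((hTcont.sub continuousOn_const).norm.pow 2)
  set r : ℕ → ℝ := fun n => ∑ g, (2 * ((x n g + a n * (T (x n) g - x n g) - q₀ g) * ξ n g) +
    ξ n g ^ 2) with hr
  have hdrift : ∀ n, a n * D (x n) ≤ ‖x n - q₀‖ ^ 2 - ‖x (n + 1) - q₀‖ ^ 2 + r n := by
    intro n
    simp only [hD, hr, EuclideanSpace.real_norm_sq_eq, PiLp.sub_apply]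
    rw [← Finset.sum_sub_distrib, ← Finset.sum_sub_distrib, ← Finset.sum_add_distrib,
      Finset.mul_sum]
    refine Finset.sum_le_sum fun g _ => ?_
    rw [hstep n g]
    -- The convexity defect a (1 - a) (T x - x)² of the square.
    have := mul_nonneg (mul_nonneg (ha0 n) (sub_nonneg.2 (ha1 n)))
      (sq_nonneg (T (x n) g - x n g))
    nlinarith
  have hpart : ∀ n, ∑ i ∈ Finset.range n, a i * D (x i) ≤
      ‖x 0 - q₀‖ ^ 2 + ∑ i ∈ Finset.range n, r i := by
    intro n
    have h1 : ∑ i ∈ Finset.range n, a i * D (x i) ≤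
        ‖x 0 - q₀‖ ^ 2 - ‖x n - q₀‖ ^ 2 + ∑ i ∈ Finset.range n, r i := by
      rw [← Finset.sum_range_sub' (fun n => ‖x n - q₀‖ ^ 2), ← Finset.sum_add_distrib]
      exact Finset.sum_le_sum fun i _ => hdrift i
    linarith [sq_nonneg ‖x n - q₀‖]
  have hrlim : ∃ l, Tendsto (fun n => ∑ i ∈ Finset.range n, r i) atTop (𝓝 l) := by
    choose l hl using hcross
    refine ⟨_, (tendsto_finsetSum Finset.univ fun g _ =>
      ((hl g).const_mul 2).add (hξ2 g).hasSum.tendsto_sum_nat).congr fun n => ?_⟩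
    simp only [hr]
    rw [Finset.sum_comm]
    refine Finset.sum_congr rfl fun g _ => ?_
    rw [Finset.sum_add_distrib, Finset.mul_sum]
  obtain ⟨l, hl⟩ := hrlim
  obtain ⟨B, hB⟩ := hl.bddAbove_range
  have hsum : Summable fun n => a n * D (x n) :=
    summable_of_sum_range_le (fun n => mul_nonneg (ha0 n) (hDnonneg _ (hx n))) fun n =>
      (hpart n).trans (add_le_add_right (hB ⟨n, rfl⟩) _)
  choose L hL using hξ
  have he : Tendsto (fun n => WithLp.toLp 2 fun g => ∑ i ∈ Finset.range n, ξ i g) atTop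
      (𝓝 (WithLp.toLp 2 L : EuclideanSpace ℝ G)) :=
    ((PiLp.continuous_toLp 2 _).tendsto L).comp (tendsto_pi_nhds.2 hL)
  obtain ⟨q, hq, hq0, hlim⟩ := tendsto_of_summable_drift (isCompact_simplex G) hTcont hDcont
    hDnonneg (fun p hp h0 => (hDfix p hp h0).2) (hA1.finite.subset fun p hp => hDfix p hp.1 hp.2)
    hx ha0 ha1 ha he.cauchySeq (fun n => by
      ext g
      simp [hstep n g, Finset.sum_range_succ]) hsum
  exact ⟨q, hDfix q hq hq0, hlim⟩

/-! ### Almost sure convergence to a fixed point -/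

section urn

variable {G Ω : Type*} [Fintype G] [DecidableEq G] [mΩ : MeasurableSpace Ω] {μ : Measure Ω}
  [IsProbabilityMeasure μ] {T : EuclideanSpace ℝ G → EuclideanSpace ℝ G}
  {q₀ p₀ : EuclideanSpace ℝ G} {k₀ : ℕ} {k : ℕ → Ω → ℕ} {X : ℕ → Ω → G}

omit [Fintype G] [DecidableEq G] mΩ in
theorem tendsto_count_atTop (hkmono : ∀ n ω, k n ω + 1 ≤ k (n + 1) ω) (ω : Ω) :
    Tendsto (fun n => (k n ω : ℝ)) atTop atTop :=
  tendsto_natCast_atTop_atTop.comp (strictMono_nat_of_lt_succ fun n => hkmono n ω).tendsto_atTop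

/-- The rescaled deviations of one colour have almost surely convergent sums, also after
multiplication by bounded predictable coefficients. -/
theorem ae_tendsto_sum_noise
    (hTmaps : Set.MapsTo T (simplex G) (simplex G)) (hTcont : ContinuousOn T (simplex G))
    (hp₀ : p₀ ∈ simplex G) (hk₀ : 0 < k₀)
    (hkinit : ∀ ω, k 0 ω = k₀) (hkmeas : ∀ n, Measurable (k n))
    (hkmono : ∀ n ω, k n ω + 1 ≤ k (n + 1) ω) (hXmeas : ∀ i, Measurable[mΩ, ⊤] (X i))
    (hmult : ∀ n ≥ 1, ∀ m : G → ℕ,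
      μ[Set.indicator {ω | batchSum k X n ω = m} (fun _ => (1 : ℝ)) | urnSigma k X n] =ᵐ[μ]
        fun ω => multinomialProb (T (empirical k X p₀ n ω)) (k (n + 1) ω - k n ω) m)
    (hkbdd : ∀ n, ∃ M : ℕ, ∀ᵐ ω ∂μ, k n ω ≤ M) (g : G) {c : ℕ → Ω → ℝ}
    (hcm : ∀ n, Measurable[urnSigma k X (n + 1)] (c n)) (hc : ∀ n ω, |c n ω| ≤ 1) :
    ∀ᵐ ω ∂μ,
      (∃ l, Tendsto (fun n => ∑ i ∈ Finset.range n, c i ω * (1 / (k (i + 2) ω : ℝ) *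
        ((batchSum k X (i + 1) ω g : ℝ) - ((k (i + 2) ω : ℝ) - k (i + 1) ω) *
          T (empirical k X p₀ (i + 1) ω) g))) atTop (𝓝 l)) ∧
      Summable fun n => (c n ω * (1 / (k (n + 2) ω : ℝ) *
        ((batchSum k X (n + 1) ω g : ℝ) - ((k (n + 2) ω : ℝ) - k (n + 1) ω) *
          T (empirical k X p₀ (n + 1) ω) g))) ^ 2 := by
  have hkpos : ∀ n ω, (1 : ℝ) ≤ k n ω := fun n ω => by
    exact_mod_cast count_pos hkinit hk₀ hkmono n ω
  have hcast : ∀ n ω, ((k (n + 1) ω - k n ω : ℕ) : ℝ) = (k (n + 1) ω : ℝ) - k n ω := fun n ω =>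
    Nat.cast_sub (by have := hkmono n ω; omega)
  have hkle : ∀ n ω, (k n ω : ℝ) ≤ k (n + 1) ω := fun n ω => by
    exact_mod_cast (Nat.le_succ _).trans (hkmono n ω)
  have hinv : ∀ n ω, 1 / (k n ω : ℝ) ≤ 1 := fun n ω => by
    rw [div_le_one (by linarith [hkpos n ω])]
    exact hkpos n ω
  have hmain := ae_tendsto_sum_deviation hTmaps hTcont hp₀ hk₀ hkinit hkmeas hkmono hXmeas hmult
    hkbdd {g} (w := fun n ω => c n ω * (1 / (k (n + 2) ω : ℝ))) (K := 1)
    (fun n => (hcm n).mul (measurable_const.div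
      (measurable_from_top.comp (measurable_count_urnSigma hkinit le_rfl)))) ?_ ?_
  · filter_upwards [hmain] with ω h
    simpa only [Finset.sum_singleton, hcast, mul_assoc] using h
  · intro n ω
    have h0 : (0 : ℝ) ≤ 1 / (k (n + 2) ω : ℝ) := by positivity
    rw [abs_mul, abs_of_nonneg h0]
    exact mul_le_one₀ (hc n ω) h0 (hinv _ _)
  · intro n ω
    -- The variance bound (k' - k) / k'² ≤ 1 / k - 1 / k' telescopes.
    calc _ ≤ ∑ i ∈ Finset.range n, (1 / (k (i + 1) ω : ℝ) - 1 / (k (i + 1 + 1) ω : ℝ)) := by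
          refine Finset.sum_le_sum fun i _ => ?_
          have hT := hTmaps (empirical_mem_simplex (X := X) hkinit hk₀ hkmono hp₀ (i + 1) ω)
          have h1 := apply_le_one_of_mem_simplex hT g
          have h2 := hT.1 g
          have h3 : (c i ω) ^ 2 ≤ 1 := (sq_le_one_iff_abs_le_one _).2 (hc i ω)
          have h4 := hkle (i + 1) ω
          have h5 := hkpos (i + 1) ω
          have h6 := hkpos (i + 2) ω
          rw [Finset.sum_singleton, hcast, mul_pow]
          calc c i ω ^ 2 * (1 / (k (i + 2) ω : ℝ)) ^ 2 * (((k (i + 1 + 1) ω : ℝ) - k (i + 1) ω) *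
                T (empirical k X p₀ (i + 1) ω) g)
              ≤ 1 * (1 / (k (i + 2) ω : ℝ)) ^ 2 * (((k (i + 1 + 1) ω : ℝ) - k (i + 1) ω) * 1) := by
                have h7 : 0 ≤ (k (i + 1 + 1) ω : ℝ) - k (i + 1) ω := sub_nonneg.2 h4
                gcongr
            _ ≤ 1 / (k (i + 1) ω : ℝ) - 1 / (k (i + 1 + 1) ω : ℝ) := by
                rw [div_sub_div _ _ (by positivity) (by positivity), one_mul, mul_one, one_mul,
                  mul_one, div_pow, one_pow, one_div_mul_eq_div]
                refine div_le_div_of_nonneg_left (sub_nonneg.2 h4) (by positivity) ?_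
                rw [sq]
                exact mul_le_mul_of_nonneg_right h4 (by positivity)
      _ = 1 / (k 1 ω : ℝ) - 1 / (k (n + 1) ω : ℝ) :=
          Finset.sum_range_sub' (fun i => 1 / (k (i + 1) ω : ℝ)) n
      _ ≤ 1 := by
          have : (0 : ℝ) ≤ 1 / (k (n + 1) ω : ℝ) := by positivity
          linarith [hinv 1 ω]

/-- The empirical distributions almost surely converge to some fixed point. -/
theorem ae_exists_tendsto_fixedPt
    (hTmaps : Set.MapsTo T (simplex G) (simplex G)) (hTcont : ContinuousOn T (simplex G))
    (hp₀ : p₀ ∈ simplex G) (hk₀ : 0 < k₀)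
    (hkinit : ∀ ω, k 0 ω = k₀) (hkmeas : ∀ n, Measurable (k n))
    (hkmono : ∀ n ω, k n ω + 1 ≤ k (n + 1) ω) (hXmeas : ∀ i, Measurable[mΩ, ⊤] (X i))
    (hmult : ∀ n ≥ 1, ∀ m : G → ℕ,
      μ[Set.indicator {ω | batchSum k X n ω = m} (fun _ => (1 : ℝ)) | urnSigma k X n] =ᵐ[μ]
        fun ω => multinomialProb (T (empirical k X p₀ n ω)) (k (n + 1) ω - k n ω) m)
    (hkbdd : ∀ n, ∃ M : ℕ, ∀ᵐ ω ∂μ, k n ω ≤ M) (hA1 : ConditionA1 T q₀) :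
    ∀ᵐ ω ∂μ, ∃ q ∈ fixedPts T, Tendsto (fun n => empirical k X p₀ n ω) atTop (𝓝 q) := by
  have hkpos : ∀ n ω, (0 : ℝ) < k n ω := fun n ω => by
    exact_mod_cast count_pos hkinit hk₀ hkmono n ω
  have hkle : ∀ n ω, (k n ω : ℝ) ≤ k (n + 1) ω := fun n ω => by
    exact_mod_cast (Nat.le_succ _).trans (hkmono n ω)
  have ha0 : ∀ n ω, 0 ≤ 1 - (k n ω : ℝ) / k (n + 1) ω := fun n ω => by
    rw [sub_nonneg, div_le_one (hkpos _ _)]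
    exact hkle n ω
  have ha1 : ∀ n ω, 1 - (k n ω : ℝ) / k (n + 1) ω ≤ 1 := fun n ω => by
    have : 0 ≤ (k n ω : ℝ) / k (n + 1) ω := by positivity
    linarith
  have hmem := empirical_mem_simplex (X := X) hkinit hk₀ hkmono hp₀
  have hnoise : ∀ᵐ ω ∂μ, ∀ g, _ := ae_all_iff.2 fun g => ae_tendsto_sum_noise hTmaps hTcont hp₀
    hk₀ hkinit hkmeas hkmono hXmeas hmult hkbdd g (c := fun _ _ => 1)
    (fun n => measurable_const) (fun n ω => by simp)
  -- The coefficient is a coordinate of (1 - a) p + a T p - q₀: predictable, and in [-1, 1] as a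
  -- difference of coordinates of two distributions.
  have hcross : ∀ᵐ ω ∂μ, ∀ g, _ := ae_all_iff.2 fun g => ae_tendsto_sum_noise hTmaps hTcont hp₀
    hk₀ hkinit hkmeas hkmono hXmeas hmult hkbdd g
    (c := fun n ω => empirical k X p₀ (n + 1) ω g + (1 - (k (n + 1) ω : ℝ) / k (n + 2) ω) *
      (T (empirical k X p₀ (n + 1) ω) g - empirical k X p₀ (n + 1) ω g) - q₀ g)
    (fun n => by
      have h1 : Measurable[urnSigma k X (n + 1)] fun ω => (k (n + 1) ω : ℝ) :=
        measurable_from_top.comp (measurable_count_urnSigma hkinit (by omega))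
      have h2 : Measurable[urnSigma k X (n + 1)] fun ω => (k (n + 2) ω : ℝ) :=
        measurable_from_top.comp (measurable_count_urnSigma hkinit (by omega))
      have h3 := measurable_empirical_apply (X := X) hkinit hkmono p₀ (n + 1) g
      have h4 := measurable_map_empirical_apply (X := X) hkinit hk₀ hkmono hp₀ hTcont (n + 1) g
      exact (h3.add ((measurable_const.sub (h1.div h2)).mul (h4.sub h3))).sub measurable_const)
    (fun n ω => by
      have hp := hmem (n + 1) ω
      have h1 := hp.1 g
      have h2 := apply_le_one_of_mem_simplex hp g
      have h3 := (hTmaps hp).1 g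
      have h4 := apply_le_one_of_mem_simplex (hTmaps hp) g
      have h5 := hA1.mem.1.1 g
      have h6 := apply_le_one_of_mem_simplex hA1.mem.1 g
      have h7 := ha0 (n + 1) ω
      have h8 := ha1 (n + 1) ω
      rw [abs_le]
      constructor <;> nlinarith)
  filter_upwards [hnoise, hcross] with ω h1 h2
  obtain ⟨q, hq, hlim⟩ := exists_tendsto_fixedPt_of_perturbation hTcont hA1
    (x := fun n => empirical k X p₀ (n + 1) ω) (fun n => hmem (n + 1) ω)
    (a := fun n => 1 - (k (n + 1) ω : ℝ) / k (n + 2) ω)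
    (fun n => ha0 (n + 1) ω) (fun n => ha1 (n + 1) ω)
    (not_summable_one_sub_div_succ (k := fun n => (k (n + 1) ω : ℝ)) (fun n => hkpos _ _)
      (fun n => hkle _ _) ((tendsto_count_atTop hkmono ω).comp (tendsto_add_atTop_nat 1)))
    (ξ := fun n g => 1 / (k (n + 2) ω : ℝ) *
        ((batchSum k X (n + 1) ω g : ℝ) - ((k (n + 2) ω : ℝ) - k (n + 1) ω) *
          T (empirical k X p₀ (n + 1) ω) g))
    (fun n g => by
      rw [empirical_succ_apply]
      have := (hkpos (n + 2) ω).ne'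
      field_simp
      ring)
    (fun g => by simpa using (h1 g).1) (fun g => by simpa using (h1 g).2) (fun g => (h2 g).1)
  exact ⟨q, hq, (tendsto_add_atTop_iff_nat 1).1 hlim⟩

/-! ### Repulsion from the other fixed points -/

omit [DecidableEq G] in
theorem inner_missingVec (q p : EuclideanSpace ℝ G) [DecidablePred fun g => q g = 0] :
    inner ℝ (missingVec q) p = ∑ g with q g = 0, p g := by
  classical
  rw [Finset.sum_filter, PiLp.inner_apply]
  refine Finset.sum_congr rfl fun g _ => ?_
  by_cases h : q g = 0 <;> simp [missingVec, h]

/-- The empirical distributions almost surely avoid a repelling fixed point. -/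
theorem ae_not_tendsto_fixedPt
    (hTmaps : Set.MapsTo T (simplex G) (simplex G)) (hTcont : ContinuousOn T (simplex G))
    (hp₀ : p₀ ∈ simplex G) (hk₀ : 0 < k₀)
    (hkinit : ∀ ω, k 0 ω = k₀) (hkmeas : ∀ n, Measurable (k n))
    (hkmono : ∀ n ω, k n ω + 1 ≤ k (n + 1) ω) (hXmeas : ∀ i, Measurable[mΩ, ⊤] (X i))
    (hmult : ∀ n ≥ 1, ∀ m : G → ℕ,
      μ[Set.indicator {ω | batchSum k X n ω = m} (fun _ => (1 : ℝ)) | urnSigma k X n] =ᵐ[μ]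
        fun ω => multinomialProb (T (empirical k X p₀ n ω)) (k (n + 1) ω - k n ω) m)
    (hkbdd : ∀ n, ∃ M : ℕ, ∀ᵐ ω ∂μ, k n ω ≤ M) (hA2 : ConditionA2 T q₀ p₀)
    {q : EuclideanSpace ℝ G} (hq : q ∈ fixedPts T) (hqq₀ : q ≠ q₀) :
    ∀ᵐ ω ∂μ, ¬ Tendsto (fun n => empirical k X p₀ n ω) atTop (𝓝 q) := by
  classical
  have hkpos : ∀ n ω, (0 : ℝ) < k n ω := fun n ω => by
    exact_mod_cast count_pos hkinit hk₀ hkmono n ω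
  have hkle : ∀ n ω, (k n ω : ℝ) ≤ k (n + 1) ω := fun n ω => by
    exact_mod_cast (Nat.le_succ _).trans (hkmono n ω)
  have hcast : ∀ n ω, ((k (n + 1) ω - k n ω : ℕ) : ℝ) = (k (n + 1) ω : ℝ) - k n ω := fun n ω =>
    Nat.cast_sub (by have := hkmono n ω; omega)
  have hmem := empirical_mem_simplex (X := X) hkinit hk₀ hkmono hp₀
  set S : Finset G := Finset.univ.filter fun g => q g = 0 with hS
  set τ : ℕ → Ω → ℝ := fun n ω => ∑ g ∈ S, T (empirical k X p₀ (n + 1) ω) g with hτ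
  have hτ0 : ∀ n ω, 0 ≤ τ n ω := fun n ω =>
    Finset.sum_nonneg fun g _ => (hTmaps (hmem (n + 1) ω)).1 g
  -- Compensator of the number of draws in S. As k (n + 2) is already known at stage n + 1, A (n +
  -- 1) is predictable and can serve in the weight.
  set A : ℕ → Ω → ℝ := fun n ω =>
    ∑ i ∈ Finset.range n, ((k (i + 2) ω : ℝ) - k (i + 1) ω) * τ i ω with hA
  have hA0 : ∀ n ω, 0 ≤ A n ω := fun n ω =>
    Finset.sum_nonneg fun i _ => mul_nonneg (sub_nonneg.2 (hkle (i + 1) ω)) (hτ0 i ω)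
  have hAsucc : ∀ n ω, A (n + 1) ω = A n ω + ((k (n + 2) ω : ℝ) - k (n + 1) ω) * τ n ω :=
    fun n ω => Finset.sum_range_succ _ _
  have hσ : Monotone (urnSigma k X) := monotone_nat_of_le_succ (urnSigma_mono_succ hkinit hkmono)
  have hAm : ∀ n, Measurable[urnSigma k X (n + 1)] (A (n + 1)) := by
    intro n
    refine Finset.measurable_fun_sum _ fun i hi => ?_
    have hin : i + 1 ≤ n + 1 := Finset.mem_range.1 hi
    have h1 : Measurable[urnSigma k X (n + 1)] fun ω => (k (i + 1) ω : ℝ) :=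
      measurable_from_top.comp (measurable_count_urnSigma hkinit (by omega))
    have h2 : Measurable[urnSigma k X (n + 1)] fun ω => (k (i + 2) ω : ℝ) :=
      measurable_from_top.comp (measurable_count_urnSigma hkinit (by omega))
    exact (h2.sub h1).mul (Finset.measurable_fun_sum _ fun g _ =>
      (measurable_map_empirical_apply hkinit hk₀ hkmono hp₀ hTcont (i + 1) g).mono (hσ hin) le_rfl)
  have hmain := ae_tendsto_sum_deviation hTmaps hTcont hp₀ hk₀ hkinit hkmeas hkmono hXmeas hmult
    hkbdd S (w := fun n ω => 1 / (1 + A (n + 1) ω)) (K := 1)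
    (fun n => measurable_const.div (measurable_const.add (hAm n))) ?_ ?_
  · filter_upwards [hmain] with ω h hlim
    obtain ⟨⟨l, hl⟩, -⟩ := h
    have hlim1 : Tendsto (fun n => empirical k X p₀ (n + 1) ω) atTop (𝓝 q) :=
      hlim.comp (tendsto_add_atTop_nat 1)
    have hstep : ∀ n, (k (n + 1) ω : ℝ) * ∑ g ∈ S, empirical k X p₀ (n + 1) ω g =
        (k n ω : ℝ) * ∑ g ∈ S, empirical k X p₀ n ω g +
          ((∑ g ∈ S, batchSum k X n ω g : ℕ) : ℝ) := by
      intro n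
      simp_rw [empirical_succ_apply]
      rw [Finset.sum_add_distrib, ← Finset.mul_sum, ← Finset.mul_sum, Nat.cast_sum]
      have := (hkpos (n + 1) ω).ne'
      field_simp
    -- Counts in S never decrease, so the initial mass persists; this keeps the path in the set
    -- where the lower limit of A2 is taken.
    have hypos : ∀ n, 0 < ∑ g ∈ S, empirical k X p₀ n ω g := by
      intro n
      induction n with
      | zero =>
        have := hA2.init_pos q hq hqq₀
        rwa [inner_missingVec] at this
      | succ n ih =>
        have h1 : 0 < (k (n + 1) ω : ℝ) * ∑ g ∈ S, empirical k X p₀ (n + 1) ω g := by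
          rw [hstep]
          have := hkpos n ω
          positivity
        exact pos_of_mul_pos_right h1 (hkpos _ _).le
    obtain ⟨lam, hlam1, hlam⟩ := EReal.lt_iff_exists_real_btwn.1 (hA2.repelling q hq hqq₀)
    have hwithin : Tendsto (fun n => empirical k X p₀ (n + 1) ω) atTop
        (𝓝[{p | p ∈ simplex G ∧ inner ℝ (missingVec q) p ≠ 0}] q) := by
      refine tendsto_nhdsWithin_iff.2 ⟨hlim1, .of_forall fun n => ⟨hmem _ _, ?_⟩⟩
      rw [inner_missingVec]
      exact (hypos (n + 1)).ne'
    have hrep : ∀ᶠ n in atTop,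
        lam * ∑ g ∈ S, empirical k X p₀ (n + 1) ω g ≤ τ n ω := by
      filter_upwards [hwithin.eventually (eventually_lt_of_lt_liminf hlam)] with n hn
      rw [EReal.coe_lt_coe_iff, inner_missingVec, inner_missingVec,
        lt_div_iff₀ (hypos (n + 1))] at hn
      exact hn.le
    have hy : Tendsto (fun n => ∑ g ∈ S, empirical k X p₀ (n + 1) ω g) atTop (𝓝 0) := by
      have h1 : Continuous fun p : EuclideanSpace ℝ G => ∑ g ∈ S, p g := by fun_prop
      have h2 := (h1.tendsto q).comp hlim1
      have h3 : ∑ g ∈ S, q g = 0 :=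
        Finset.sum_eq_zero fun g hg => (Finset.mem_filter.1 hg).2
      rwa [h3] at h2
    refine not_tendsto_zero_of_compensator (k := fun n => (k (n + 1) ω : ℝ))
      (y := fun n => ∑ g ∈ S, empirical k X p₀ (n + 1) ω g)
      (b := fun n => ((∑ g ∈ S, batchSum k X (n + 1) ω g : ℕ) : ℝ)) (τ := fun n => τ n ω)
      (A := fun n => A n ω) (l := l) (by exact_mod_cast hlam1) (fun n => hkpos _ _)
      (fun n => hkle _ _) ((tendsto_count_atTop hkmono ω).comp (tendsto_add_atTop_nat 1))
      (hypos 1) (fun n => Nat.cast_nonneg _) (fun n => hτ0 n ω) (fun n => hstep (n + 1))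
      (by simp [hA]) (fun n => hAsucc n ω) hrep ?_ hy
    simpa only [hcast] using hl
  · intro n ω
    have := hA0 (n + 1) ω
    rw [abs_of_nonneg (by positivity), div_le_one (by linarith)]
    linarith
  · intro n ω
    -- With weights 1 / (1 + A'), where A' is the next value of A, the variances are at most (A' -
    -- A) / (1 + A')² ≤ 1 / (1 + A) - 1 / (1 + A').
    calc _ ≤ ∑ i ∈ Finset.range n, (1 / (1 + A i ω) - 1 / (1 + A (i + 1) ω)) := by
          refine Finset.sum_le_sum fun i _ => ?_
          have h1 := hA0 i ω
          have h2 := hA0 (i + 1) ω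
          have h3 : ((k (i + 1 + 1) ω : ℝ) - k (i + 1) ω) * τ i ω = A (i + 1) ω - A i ω := by
            rw [hAsucc]
            ring
          have h4 : 0 ≤ A (i + 1) ω - A i ω := by
            rw [← h3]
            exact mul_nonneg (sub_nonneg.2 (hkle (i + 1) ω)) (hτ0 i ω)
          rw [hcast]
          change (1 / (1 + A (i + 1) ω)) ^ 2 *
            (((k (i + 1 + 1) ω : ℝ) - k (i + 1) ω) * τ i ω) ≤ _
          rw [h3, div_sub_div _ _ (by positivity) (by positivity), div_pow, one_pow,
            one_div_mul_eq_div, one_mul, mul_one, add_sub_add_left_eq_sub]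
          refine div_le_div_of_nonneg_left h4 (by positivity) ?_
          rw [sq]
          exact mul_le_mul_of_nonneg_right (by linarith) (by positivity)
      _ = 1 / (1 + A 0 ω) - 1 / (1 + A n ω) := Finset.sum_range_sub' (fun i => 1 / (1 + A i ω)) n
      _ ≤ 1 := by
          have := hA0 n ω
          have h1 : 0 ≤ 1 / (1 + A n ω) := by positivity
          have h2 : A 0 ω = 0 := by simp [hA]
          rw [h2]
          linarith

end urn

/-! ### Conclusion -/

theorem theorem2 {G : Type*} [Fintype G] [DecidableEq G]
    {Ω : Type*} [mΩ : MeasurableSpace Ω] (μ : Measure Ω) [IsProbabilityMeasure μ]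
    (T : EuclideanSpace ℝ G → EuclideanSpace ℝ G)
    (hTmaps : Set.MapsTo T (simplex G) (simplex G))
    (hTcont : ContinuousOn T (simplex G))
    (q₀ p₀ : EuclideanSpace ℝ G) (hp₀ : p₀ ∈ simplex G)
    (k₀ : ℕ) (hk₀ : 0 < k₀)
    (k : ℕ → Ω → ℕ) (hkinit : ∀ ω, k 0 ω = k₀)
    (hkmeas : ∀ n, Measurable (k n))
    (hkmono : ∀ n ω, k n ω + 1 ≤ k (n + 1) ω)
    (X : ℕ → Ω → G) (hXmeas : ∀ i, Measurable[mΩ, ⊤] (X i))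
    (hmult : ∀ n ≥ 1, ∀ m : G → ℕ,
      μ[Set.indicator {ω | batchSum k X n ω = m} (fun _ => (1 : ℝ)) | urnSigma k X n] =ᵐ[μ]
        fun ω => multinomialProb (T (empirical k X p₀ n ω)) (k (n + 1) ω - k n ω) m)
    (hA1 : ConditionA1 T q₀) (hA2 : ConditionA2 T q₀ p₀) (hA3 : ConditionA3 μ T k) :
    ∀ᵐ ω ∂μ, Tendsto (fun n => empirical k X p₀ n ω) atTop (𝓝 q₀) := by
  obtain ⟨C, hC, -, hratio⟩ := hA3
  have hkbdd := exists_ae_count_le hkinit hk₀ hkmono hC hratio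
  -- Finiteness of the fixed point set allows a single null set for all the excluded limits.
  have hnot : ∀ᵐ ω ∂μ, ∀ q ∈ fixedPts T \ {q₀},
      ¬ Tendsto (fun n => empirical k X p₀ n ω) atTop (𝓝 q) :=
    (ae_ball_iff (hA1.finite.subset Set.sdiff_subset).countable).2 fun q hq =>
      ae_not_tendsto_fixedPt hTmaps hTcont hp₀ hk₀ hkinit hkmeas hkmono hXmeas hmult hkbdd hA2
        hq.1 hq.2
  filter_upwards [hnot, ae_exists_tendsto_fixedPt hTmaps hTcont hp₀ hk₀ hkinit hkmeas hkmono
    hXmeas hmult hkbdd hA1] with ω h1 h2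
  obtain ⟨q, hq, hlim⟩ := h2
  by_cases hqq₀ : q = q₀
  · rwa [← hqq₀]
  · exact absurd hlim (h1 q ⟨hq, hqq₀⟩)
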